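/- Let $(M,d)$ be a compact metric space with a finite Borel measure $m$ (for instance a compact connected smooth Riemannian manifold without boundary, with its Riemannian distance and its Riemannian measure). Suppose that $\Theta:(0,\infty)\to\mathbb{R}$ is such that $r\mapsto\Theta(e^r)$ is strictly increasing and convex on $\mathbb{R}$, with $\Theta(e^r)\to\infty$ as $r\to\infty$ and $\Theta(e^r)\to0$ as $r\to-\infty$. A probability density is a $\rho\in L^1(M;m)$ with $\rho\ge0$ almost everywhere and $\int_M\rho\,dm=1$. For probability densities $\rho,f$ write $$W_2^2(\rho,f)=\inf_\pi\iint_{M\times M}\tfrac12 d(x,y)^2\,\pi(dx\,dy),$$ where $\pi$ runs over the probability measures on $M\times M$ with marginals $\rho\,dm$ and $f\,dm$, and write $$\mathcal{E}(\rho;f)=W_2^2(\rho,f)+\int_M\rho(x)\Theta(\rho(x))\,m(dx),$$ with $x\Theta(x)=0$ at $x=0$. (i) Every probability density $\rho$ satisfies, as an inequality in $[0,\infty]$, $$\int_M\rho(x)\Theta(\rho(x))\,m(dx)\le2\Theta(4)+2\int_0^\infty\Theta\Bigl(\frac{2}{m\{x:\rho(x)>\lambda\}}\Bigr)m\{x:\rho(x)>\lambda\}\,d\lambda,$$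 where the integrand on the right is $0$ when $m\{x:\rho(x)>\lambda\}=0$. Suppose further that $f$ is a probability density with $\int_Mf(x)\Theta(f(x))\,m(dx)<K$ for some $K>1$, and let $\Omega_K$ be the set of probability densities $\rho$ with $\mathcal{E}(\rho;f)\le K$. (ii) $\Omega_K$ is closed (in the norm topology and in the weak topology), convex and weakly sequentially compact in $L^1(M;m)$. (iii) The functional $\rho\mapsto\mathcal{E}(\rho;f)$ on $\Omega_K$ attains its infimum at a unique point $\rho_1\in\Omega_K$. (iv) Say that a function $F$ satisfies the $\Delta_2$ condition if there is $C>0$ such that $F(2x)\le C\,F(x)$ for all $x>0$. If $U(x)=x\Theta(x)$ and its Legendre transform $v\mapsto\sup_{u>0}(uv-u\Theta(u))$ both satisfy the $\Delta_2$ condition, then $U$ (with $U(0)=0$) is an Orlicz function, that is, a convex function $[0,\infty)\to[0,\infty)$ with $U(0)=0$ and $U(x)\to\infty$ as $x\to\infty$. It determines the Orlicz space $L_U$ of (classes of) measurable $u:M\to\mathbb{R}$ for which the norm $$\|u\|_{L_U}=\inf\Bigl\{\lambda>0:\int_MU\bigl(|u(x)|/\lambda\bigr)\,m(dx)\le1\Bigr\}$$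 is finite; $\Omega_K$ is contained in $L_U$ and is compact for the weak topology of $L_U$. -/

import Mathlib

open Set Filter Topology MeasureTheory
open scoped NNReal ENNReal

noncomputable section

/-! ### Densities, transport cost and energy -/

section Energy

variable {M : Type*} [MeasurableSpace M]

/-- `ρ ∈ L¹(m)` is a probability density function with respect to `m`. -/
def IsProbDensity (m : Measure M) (ρ : Lp ℝ 1 m) : Prop :=
  (∀ᵐ x ∂m, 0 ≤ ρ x) ∧ ∫ x, ρ x ∂m = 1

/-- The measure `ρ dm`. -/
def densityMeasure (m : Measure M) (ρ : Lp ℝ 1 m) : Measure M :=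
  m.withDensity fun x => ENNReal.ofReal (ρ x)

/-- The squared Wasserstein distance `W₂²(μ, ν)`, normalised with the cost `d(x, y)² / 2`: the
infimum of `∬ d(x, y)² / 2 dπ` over the probability measures `π` on the product with marginals
`μ` and `ν`. -/
def wassersteinSq [PseudoEMetricSpace M] (μ ν : Measure M) : ℝ≥0∞ :=
  ⨅ (π : Measure (M × M)) (_ : IsProbabilityMeasure π ∧ π.map Prod.fst = μ ∧ π.map Prod.snd = ν),
    ∫⁻ z, edist z.1 z.2 ^ 2 / 2 ∂π

/-- The internal energy `∫ ρ Θ(ρ) dm` as an integral of a nonnegative function, with values in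
`[0, ∞]`. -/
def internalEnergy (Θ : ℝ → ℝ) (m : Measure M) (ρ : Lp ℝ 1 m) : ℝ≥0∞ :=
  ∫⁻ x, ENNReal.ofReal (ρ x * Θ (ρ x)) ∂m

/-- The energy `𝓔(ρ; f) = W₂²(ρ, f) + ∫ ρ Θ(ρ) dm`. -/
def totalEnergy [PseudoEMetricSpace M] (Θ : ℝ → ℝ) (m : Measure M) (f ρ : Lp ℝ 1 m) : ℝ≥0∞ :=
  wassersteinSq (densityMeasure m ρ) (densityMeasure m f) + internalEnergy Θ m ρ

/-- The set `Ω_K` of probability densities whose energy relative to `f` is at most `K`. -/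
def energySublevel [PseudoEMetricSpace M] (Θ : ℝ → ℝ) (m : Measure M) (f : Lp ℝ 1 m) (K : ℝ) :
    Set (Lp ℝ 1 m) :=
  {ρ | IsProbDensity m ρ ∧ totalEnergy Θ m f ρ ≤ ENNReal.ofReal K}

end Energy

/-! ### Legendre transform and the `Δ₂` condition -/

/-- The Legendre transform `v ↦ sup {u v - F u : u > 0}`. -/
def legendreTransform (F : ℝ → ℝ) (v : ℝ) : ℝ :=
  ⨆ u : Ioi (0 : ℝ), ((u : ℝ) * v - F u)

/-- The `Δ₂` condition: `F (2 x) ≤ C F x` for all `x > 0`, for some constant `C > 0`. -/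
def DeltaTwo (F : ℝ → ℝ) : Prop :=
  ∃ C : ℝ, 0 < C ∧ ∀ x : ℝ, 0 < x → F (2 * x) ≤ C * F x

/-! ### Orlicz spaces -/

/-- An Orlicz function: a convex function `U : [0, ∞) → [0, ∞)` with `U 0 = 0` and
`U x → ∞` as `x → ∞`. -/
structure OrliczFunction where
  /-- the underlying function -/
  toFun : ℝ≥0 → ℝ≥0
  map_zero' : toFun 0 = 0
  convex' : ConvexOn ℝ≥0 univ toFun
  tendsto' : Tendsto toFun atTop atTop

namespace OrliczFunction

instance : CoeFun OrliczFunction fun _ => ℝ≥0 → ℝ≥0 := ⟨toFun⟩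

variable (U : OrliczFunction)

theorem map_zero : U 0 = 0 := U.map_zero'

theorem map_combo_le {a b : ℝ≥0} (h : a + b = 1) (x y : ℝ≥0) :
    U (a * x + b * y) ≤ a * U x + b * U y := by
  simpa using U.convex'.2 (mem_univ x) (mem_univ y) zero_le zero_le h

theorem map_mul_le {a : ℝ≥0} (h : a ≤ 1) (x : ℝ≥0) : U (a * x) ≤ a * U x := by
  have := U.map_combo_le (a := a) (b := 1 - a) (add_tsub_cancel_of_le h) x 0
  simpa [U.map_zero] using this

theorem monotone : Monotone U := by
  intro x y hxy
  rcases eq_or_ne y 0 with rfl | hy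
  · rw [le_antisymm hxy zero_le]
  · have h1 : x / y ≤ 1 := by
      rw [div_le_iff₀ (pos_iff_ne_zero.mpr hy)]; simpa using hxy
    have h2 := U.map_mul_le h1 y
    rw [div_mul_cancel₀ _ hy] at h2
    exact h2.trans (mul_le_of_le_one_left zero_le h1)

theorem measurable : Measurable U := U.monotone.measurable

variable {α : Type*} [MeasurableSpace α] {m : Measure α}

/-- The modular `∫ U(|u|) dm` of a real measurable function `u`. -/
def modular (m : Measure α) (u : α →ₘ[m] ℝ) : ℝ≥0∞ :=
  ∫⁻ x, (U ‖u x‖₊ : ℝ≥0∞) ∂m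

theorem modular_zero : U.modular m 0 = 0 := by
  have : (fun x => (U ‖(0 : α →ₘ[m] ℝ) x‖₊ : ℝ≥0∞)) =ᵐ[m] fun _ => 0 := by
    filter_upwards [AEEqFun.coeFn_zero (α := α) (μ := m) (β := ℝ)] with x hx
    simp [hx, U.map_zero]
  rw [modular, lintegral_congr_ae this, lintegral_zero]

theorem aemeasurable_modular (u : α →ₘ[m] ℝ) :
    AEMeasurable (fun x => (U ‖u x‖₊ : ℝ≥0∞)) m :=
  (U.measurable.comp_aemeasurable u.aestronglyMeasurable.aemeasurable.nnnorm).coe_nnreal_ennreal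

theorem modular_mono {u v : α →ₘ[m] ℝ} (h : ∀ᵐ x ∂m, ‖u x‖₊ ≤ ‖v x‖₊) :
    U.modular m u ≤ U.modular m v := by
  refine lintegral_mono_ae ?_
  filter_upwards [h] with x hx
  exact_mod_cast U.monotone hx

theorem modular_smul_mono {c d : ℝ} (h : |c| ≤ |d|) (u : α →ₘ[m] ℝ) :
    U.modular m (c • u) ≤ U.modular m (d • u) := by
  refine U.modular_mono ?_
  filter_upwards [AEEqFun.coeFn_smul c u, AEEqFun.coeFn_smul d u] with x h1 h2
  rw [h1, h2, ← NNReal.coe_le_coe]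
  simpa [abs_mul] using mul_le_mul_of_nonneg_right h (abs_nonneg (u x))

/-- The set of admissible scalings in the definition of the norm. -/
def scalings (m : Measure α) (u : α →ₘ[m] ℝ) : Set ℝ :=
  {l : ℝ | 0 < l ∧ U.modular m (l⁻¹ • u) ≤ 1}

/-- The Orlicz norm `inf {l > 0 : ∫ U(|u| / l) dm ≤ 1}`. -/
def orliczNorm (m : Measure α) (u : α →ₘ[m] ℝ) : ℝ := sInf (U.scalings m u)

theorem scalings_bddBelow (u : α →ₘ[m] ℝ) : BddBelow (U.scalings m u) :=
  ⟨0, fun _ hl => hl.1.le⟩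

theorem scalings_add {u v : α →ₘ[m] ℝ} {k l : ℝ} (hk : k ∈ U.scalings m u)
    (hl : l ∈ U.scalings m v) : k + l ∈ U.scalings m (u + v) := by
  obtain ⟨hk0, hk⟩ := hk
  obtain ⟨hl0, hl⟩ := hl
  have hkl : 0 < k + l := by positivity
  refine ⟨hkl, ?_⟩
  lift k to ℝ≥0 using hk0.le
  lift l to ℝ≥0 using hl0.le
  have hk1 : (k : ℝ) ≠ 0 := hk0.ne'
  have hl1 : (l : ℝ) ≠ 0 := hl0.ne'
  have hkl1 : (k : ℝ) + l ≠ 0 := hkl.ne'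
  have hkl2 : k + l ≠ 0 := by exact_mod_cast hkl1
  set a : ℝ≥0 := k / (k + l) with ha
  set b : ℝ≥0 := l / (k + l) with hb
  have hab : a + b = 1 := by rw [ha, hb, ← add_div, div_self hkl2]
  calc U.modular m (((k : ℝ) + l)⁻¹ • (u + v))
      ≤ ∫⁻ x, ((a : ℝ≥0∞) * (U ‖((k : ℝ)⁻¹ • u : α →ₘ[m] ℝ) x‖₊ : ℝ≥0∞)
          + (b : ℝ≥0∞) * (U ‖((l : ℝ)⁻¹ • v : α →ₘ[m] ℝ) x‖₊ : ℝ≥0∞)) ∂m := by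
        refine lintegral_mono_ae ?_
        filter_upwards [AEEqFun.coeFn_smul ((k : ℝ) + l)⁻¹ (u + v), AEEqFun.coeFn_add u v,
          AEEqFun.coeFn_smul (k : ℝ)⁻¹ u, AEEqFun.coeFn_smul (l : ℝ)⁻¹ v] with x h1 h2 h3 h4
        have h5 : ‖(((k : ℝ) + l)⁻¹ • (u + v) : α →ₘ[m] ℝ) x‖₊ ≤
            a * ‖((k : ℝ)⁻¹ • u : α →ₘ[m] ℝ) x‖₊ + b * ‖((l : ℝ)⁻¹ • v : α →ₘ[m] ℝ) x‖₊ := by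
          rw [h1, h3, h4, ← NNReal.coe_le_coe]
          simp only [Pi.smul_apply, h2, Pi.add_apply, smul_eq_mul, NNReal.coe_add, NNReal.coe_mul,
            coe_nnnorm, Real.norm_eq_abs, abs_mul, ha, hb, NNReal.coe_div]
          rw [abs_of_pos (inv_pos.mpr hkl), abs_of_pos (inv_pos.mpr hk0),
            abs_of_pos (inv_pos.mpr hl0)]
          calc ((k : ℝ) + l)⁻¹ * |u x + v x| ≤ ((k : ℝ) + l)⁻¹ * (|u x| + |v x|) := by
                gcongr; exact abs_add_le _ _
            _ = _ := by field_simp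
        exact_mod_cast (U.monotone h5).trans (U.map_combo_le hab _ _)
    _ = a * U.modular m ((k : ℝ)⁻¹ • u) + b * U.modular m ((l : ℝ)⁻¹ • v) := by
        rw [lintegral_add_left' ((U.aemeasurable_modular _).const_mul _),
          lintegral_const_mul' _ _ ENNReal.coe_ne_top, lintegral_const_mul' _ _ ENNReal.coe_ne_top]
        rfl
    _ ≤ a * 1 + b * 1 := by gcongr
    _ = 1 := by rw [mul_one, mul_one]; exact_mod_cast hab

theorem scalings_smul {u : α →ₘ[m] ℝ} {c l : ℝ} (hc : c ≠ 0) (hl : l ∈ U.scalings m u) :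
    |c| * l ∈ U.scalings m (c • u) := by
  obtain ⟨hl0, hl⟩ := hl
  have hc' : 0 < |c| := abs_pos.mpr hc
  refine ⟨by positivity, ?_⟩
  rw [smul_smul]
  refine (U.modular_smul_mono (le_of_eq ?_) u).trans hl
  rw [abs_mul, abs_inv, abs_mul, abs_abs, abs_inv]
  field_simp

theorem scalings_zero {l : ℝ} (hl : 0 < l) : l ∈ U.scalings m (0 : α →ₘ[m] ℝ) :=
  ⟨hl, by simp [U.modular_zero]⟩

theorem orliczNorm_zero : U.orliczNorm m (0 : α →ₘ[m] ℝ) = 0 := by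
  have : U.scalings m (0 : α →ₘ[m] ℝ) = Ioi 0 :=
    Set.ext fun l => ⟨fun h => h.1, fun h => U.scalings_zero h⟩
  rw [orliczNorm, this, csInf_Ioi]

theorem orliczNorm_nonneg (u : α →ₘ[m] ℝ) : 0 ≤ U.orliczNorm m u :=
  Real.sInf_nonneg fun _ hl => hl.1.le

theorem orliczNorm_smul_le {u : α →ₘ[m] ℝ} (hu : (U.scalings m u).Nonempty) {c : ℝ} (hc : c ≠ 0) :
    U.orliczNorm m (c • u) ≤ |c| * U.orliczNorm m u := by
  have hc' : 0 < |c| := abs_pos.mpr hc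
  rw [← div_le_iff₀' hc']
  refine le_csInf hu fun l hl => ?_
  rw [div_le_iff₀' hc']
  exact csInf_le (U.scalings_bddBelow _) (U.scalings_smul hc hl)

theorem orliczNorm_smul {u : α →ₘ[m] ℝ} (hu : (U.scalings m u).Nonempty) (c : ℝ) :
    U.orliczNorm m (c • u) = |c| * U.orliczNorm m u := by
  rcases eq_or_ne c 0 with rfl | hc
  · simp [U.orliczNorm_zero]
  refine le_antisymm (U.orliczNorm_smul_le hu hc) ?_
  obtain ⟨l, hl⟩ := hu
  have h := U.orliczNorm_smul_le ⟨_, U.scalings_smul hc hl⟩ (inv_ne_zero hc)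
  rw [smul_smul, inv_mul_cancel₀ hc, one_smul, abs_inv] at h
  rwa [le_inv_mul_iff₀ (abs_pos.mpr hc)] at h

theorem orliczNorm_add_le {u v : α →ₘ[m] ℝ} (hu : (U.scalings m u).Nonempty)
    (hv : (U.scalings m v).Nonempty) :
    U.orliczNorm m (u + v) ≤ U.orliczNorm m u + U.orliczNorm m v := by
  rw [← sub_le_iff_le_add]
  refine le_csInf hu fun k hk => ?_
  rw [sub_le_iff_le_add, ← sub_le_iff_le_add']
  refine le_csInf hv fun l hl => ?_
  rw [sub_le_iff_le_add']
  exact csInf_le (U.scalings_bddBelow _) (U.scalings_add hk hl)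

theorem modular_le_one_of_orliczNorm_lt {u : α →ₘ[m] ℝ} (hu : (U.scalings m u).Nonempty) {l : ℝ}
    (hl : U.orliczNorm m u < l) : U.modular m (l⁻¹ • u) ≤ 1 := by
  obtain ⟨k, hk, hkl⟩ := exists_lt_of_csInf_lt hu hl
  refine (U.modular_smul_mono ?_ u).trans hk.2
  have hk0 := hk.1
  rw [abs_of_pos (inv_pos.mpr hk0), abs_of_pos (inv_pos.mpr (hk0.trans hkl))]
  exact inv_anti₀ hk0 hkl.le

theorem eq_zero_of_orliczNorm_eq_zero {u : α →ₘ[m] ℝ} (hu : (U.scalings m u).Nonempty)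
    (h : U.orliczNorm m u = 0) : u = 0 := by
  have key : ∀ n : ℕ, m {x | 1 / ((n : ℝ) + 1) ≤ ‖u x‖} = 0 := by
    intro n
    set S := {x | 1 / ((n : ℝ) + 1) ≤ ‖u x‖}
    have hn : 0 < (n : ℝ) + 1 := by positivity
    have bound : ∀ k : ℕ, ((k + 1 : ℕ) : ℝ≥0∞) * m S ≤ 1 := by
      intro k
      obtain ⟨R, hR, hR0⟩ := ((U.tendsto'.eventually_ge_atTop ((k + 1 : ℕ) : ℝ≥0)).and
        (eventually_gt_atTop 0)).exists
      have hl : U.orliczNorm m u < ((R : ℝ) * (n + 1))⁻¹ := by rw [h]; positivity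
      have h1 := U.modular_le_one_of_orliczNorm_lt hu hl
      rw [inv_inv] at h1
      refine le_trans ?_ h1
      calc ((k + 1 : ℕ) : ℝ≥0∞) * m S
          ≤ ((k + 1 : ℕ) : ℝ≥0∞) *
            m {x | ((k + 1 : ℕ) : ℝ≥0∞) ≤ (U ‖(((R : ℝ) * (n + 1)) • u : α →ₘ[m] ℝ) x‖₊ : ℝ≥0∞)} := by
            gcongr _ * ?_
            refine measure_mono_ae ?_
            filter_upwards [AEEqFun.coeFn_smul ((R : ℝ) * (n + 1)) u] with x hx hxS
            have h2 : R ≤ ‖(((R : ℝ) * (n + 1)) • u : α →ₘ[m] ℝ) x‖₊ := by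
              rw [hx, ← NNReal.coe_le_coe]
              have h3 : 1 / ((n : ℝ) + 1) ≤ ‖u x‖ := hxS
              rw [div_le_iff₀ hn] at h3
              simp only [Pi.smul_apply, smul_eq_mul, coe_nnnorm, norm_mul, Real.norm_eq_abs]
              rw [abs_of_nonneg R.coe_nonneg, abs_of_pos hn, mul_assoc]
              rw [Real.norm_eq_abs] at h3
              have := R.coe_nonneg
              nlinarith
            have h4 : ((k + 1 : ℕ) : ℝ≥0) ≤ U ‖(((R : ℝ) * (n + 1)) • u : α →ₘ[m] ℝ) x‖₊ :=
              hR.trans (U.monotone h2)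
            have h5 : (((k + 1 : ℕ) : ℝ≥0) : ℝ≥0∞) ≤
                (U ‖(((R : ℝ) * (n + 1)) • u : α →ₘ[m] ℝ) x‖₊ : ℝ≥0∞) :=
              ENNReal.coe_le_coe.mpr h4
            rw [ENNReal.coe_natCast] at h5
            exact h5
        _ ≤ _ := mul_meas_ge_le_lintegral₀ (U.aemeasurable_modular _) _
    by_contra hS
    have hS' : m S ≠ ⊤ := by
      intro htop
      have := bound 0
      rw [htop] at this
      simp at this
    obtain ⟨k, hk⟩ := ENNReal.exists_nat_mul_gt hS (ENNReal.one_ne_top)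
    have h6 : (k : ℝ≥0∞) * m S ≤ ((k + 1 : ℕ) : ℝ≥0∞) * m S := by
      gcongr; simp
    exact absurd (h6.trans (bound k)) (not_le.mpr hk)
  have hae : ∀ᵐ x ∂m, ∀ n : ℕ, ‖u x‖ < 1 / ((n : ℝ) + 1) := by
    rw [ae_all_iff]
    intro n
    rw [ae_iff]
    simpa only [not_lt] using key n
  refine AEEqFun.ext ?_
  filter_upwards [hae, AEEqFun.coeFn_zero (α := α) (μ := m) (β := ℝ)] with x hx h0
  rw [h0, Pi.zero_apply, ← norm_le_zero_iff]
  refine le_of_forall_pos_lt_add fun ε hε => ?_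
  obtain ⟨n, hn⟩ := exists_nat_one_div_lt hε
  rw [zero_add]
  exact (hx n).trans hn

/-- The Orlicz space `L_U(m)`: the (classes of) real measurable functions `u` such that
`∫ U(|u| / l) dm ≤ 1` for some `l > 0`, that is, of finite Orlicz norm. -/
def orliczSpace (m : Measure α) : Submodule ℝ (α →ₘ[m] ℝ) where
  carrier := {u | (U.scalings m u).Nonempty}
  zero_mem' := ⟨1, U.scalings_zero one_pos⟩
  add_mem' := fun ⟨_, hk⟩ ⟨_, hl⟩ => ⟨_, U.scalings_add hk hl⟩
  smul_mem' := fun c u ⟨_, hl⟩ => by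
    rcases eq_or_ne c 0 with rfl | hc
    · rw [zero_smul]; exact ⟨1, U.scalings_zero one_pos⟩
    · exact ⟨_, U.scalings_smul hc hl⟩

instance : Norm (U.orliczSpace m) := ⟨fun u => U.orliczNorm m u.1⟩

theorem orliczSpace_core : NormedSpace.Core ℝ (U.orliczSpace m) where
  norm_nonneg u := U.orliczNorm_nonneg u.1
  norm_smul c u := by
    rw [Real.norm_eq_abs]; exact U.orliczNorm_smul u.2 c
  norm_triangle u v := U.orliczNorm_add_le u.2 v.2
  norm_eq_zero_iff u :=
    ⟨fun h => Subtype.ext (U.eq_zero_of_orliczNorm_eq_zero u.2 h),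
      fun h => by rw [h]; exact U.orliczNorm_zero⟩

instance : NormedAddCommGroup (U.orliczSpace m) := NormedAddCommGroup.ofCore U.orliczSpace_core

instance : NormedSpace ℝ (U.orliczSpace m) := NormedSpace.ofCore U.orliczSpace_core

end OrliczFunction

end

/-!
The function `U(x) = x Θ(x)` is a strictly convex, continuous, superlinear Orlicz function, and the
internal energy of a density is its modular for `U`
(`exists_orliczFunction_mul_theta`, `internalEnergy_eq_modular`). Convexity comes from the convexity
of `Θ ∘ exp` and of `t ↦ t log t`.

The bound by superlevel sets holds because `x Θ(x) ≤ 2 ∫_{x/2}^x Θ(2 l) dl`, by monotonicity of `Θ`;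
one integrates over `M`, exchanges the integrals and uses Chebyshev's inequality
`2 l ≤ 2 / m {ρ > l}` (`internalEnergy_le_lintegral_superlevel`).

The transport cost is convex and, since the probability measures on the compact space `M × M` form
a compact space, lower semicontinuous along `L¹` convergence; the internal energy is convex, and
lower semicontinuous by Fatou's lemma. So energy sublevels are closed and convex, hence weakly
closed. They are weakly compact because superlinearity of `U` makes the truncations at height `R`
uniformly close in `L¹`, and truncations lie in the image of a ball of `L²`
(`isCompact_weak_of_modular_le`). Sequential compactness follows because weakly compact subsets of a
separable space are metrizable. A weakly lower semicontinuous function attains its minimum on a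
weakly compact set, and strict convexity of `U` gives uniqueness.

For the Orlicz space, a continuous functional `φ` on `L_U` is given on simple functions by an
integrable density `g` (`exists_density_of_dual`), and testing `φ` against near-maximisers in the
Legendre transform `U*` shows that `∫ U*(|g| / C) dm` is finite for `C = ‖φ‖ + 1`
(`lintegral_legendre_density_le`). The `Δ₂` condition for `U` makes simple functions approximate
elements of finite modular in norm, so `φ` is the pairing with `g` on such elements. The `Δ₂`
condition for `U*` and Young's inequality make the contribution of `{|g| > k}` uniformly small on
sets of bounded modular. Hence `φ` is there a uniform limit of weakly continuous functions on `L¹`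
(`exists_bounded_density_approx`), the inclusion of the sublevel into `L_U` is weakly continuous,
and weak compactness carries over from `L¹` (`isCompact_weak_orliczSpace`).
-/

/-! ### The Orlicz function `x Θ(x)` -/

section InternalEnergyFunction

variable {Θ : ℝ → ℝ}

theorem theta_lt_theta (hmono : StrictMono fun r : ℝ => Θ (Real.exp r)) {x y : ℝ} (hx : 0 < x)
    (hxy : x < y) : Θ x < Θ y := by
  have := hmono (Real.log_lt_log hx hxy)
  simpa only [Real.exp_log hx, Real.exp_log (hx.trans hxy)] using this

theorem theta_le_theta (hmono : StrictMono fun r : ℝ => Θ (Real.exp r)) {x y : ℝ} (hx : 0 < x)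
    (hxy : x ≤ y) : Θ x ≤ Θ y := by
  rcases hxy.eq_or_lt with rfl | h
  · exact le_rfl
  · exact (theta_lt_theta hmono hx h).le

theorem theta_pos (hmono : StrictMono fun r : ℝ => Θ (Real.exp r))
    (hbot : Tendsto (fun r : ℝ => Θ (Real.exp r)) atBot (𝓝 0)) {x : ℝ} (hx : 0 < x) : 0 < Θ x := by
  -- An increasing function with limit `0` at `-∞` is nonnegative, hence positive by strictness.
  have h1 : 0 ≤ Θ (x / 2) := by
    have := hmono.monotone.le_of_tendsto hbot (Real.log (x / 2))
    simpa only [Real.exp_log (half_pos hx)] using this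
  exact h1.trans_lt (theta_lt_theta hmono (half_pos hx) (half_lt_self hx))

theorem continuousOn_theta (hconv : ConvexOn ℝ univ fun r : ℝ => Θ (Real.exp r)) :
    ContinuousOn Θ (Ioi 0) := by
  have hc : Continuous fun r : ℝ => Θ (Real.exp r) :=
    continuousOn_univ.mp (hconv.continuousOn isOpen_univ)
  refine (hc.comp_continuousOn (Real.continuousOn_log.mono fun x hx => ne_of_gt hx)).congr ?_
  intro x hx
  simp only [Function.comp, Real.exp_log (mem_Ioi.mp hx)]

theorem tendsto_theta_atTop (htop : Tendsto (fun r : ℝ => Θ (Real.exp r)) atTop atTop) :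
    Tendsto Θ atTop atTop := by
  refine (htop.comp Real.tendsto_log_atTop).congr' ?_
  filter_upwards [eventually_gt_atTop 0] with x hx
  simp only [Function.comp, Real.exp_log hx]

/-- Writing `z = a x + b y`, the convexity of `Θ ∘ exp` with the weights `a x / z` and `b y / z`
reduces the claim to the strict convexity of `t ↦ t log t`. -/
theorem mul_theta_combo_lt (hmono : StrictMono fun r : ℝ => Θ (Real.exp r))
    (hconv : ConvexOn ℝ univ fun r : ℝ => Θ (Real.exp r)) {x y a b : ℝ} (hx : 0 < x) (hy : 0 < y)
    (hxy : x ≠ y) (ha : 0 < a) (hb : 0 < b) (hab : a + b = 1) :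
    (a * x + b * y) * Θ (a * x + b * y) < a * (x * Θ x) + b * (y * Θ y) := by
  set z := a * x + b * y with hz
  have hz0 : 0 < z := by positivity
  have h1 := Real.strictConvexOn_mul_log.2 (mem_Ici.mpr hx.le) (mem_Ici.mpr hy.le) hxy ha hb hab
  simp only [smul_eq_mul, ← hz] at h1
  have h2 := hconv.2 (mem_univ (Real.log x)) (mem_univ (Real.log y))
    (show 0 ≤ a * x / z by positivity) (show 0 ≤ b * y / z by positivity)
    (by rw [← add_div, ← hz, div_self hz0.ne'])
  simp only [smul_eq_mul, Real.exp_log hx, Real.exp_log hy] at h2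
  have h3 : Real.log z < a * x / z * Real.log x + b * y / z * Real.log y := by
    rw [← mul_lt_mul_iff_right₀ hz0]
    calc z * Real.log z < _ := h1
      _ = _ := by field_simp
  have h4 := (hmono h3).trans_le h2
  simp only [Real.exp_log hz0] at h4
  calc z * Θ z < z * (a * x / z * Θ x + b * y / z * Θ y) := by gcongr
    _ = _ := by field_simp

theorem mul_theta_smul_lt (hmono : StrictMono fun r : ℝ => Θ (Real.exp r))
    {y b : ℝ} (hy : 0 < y) (hb : 0 < b) (hb1 : b < 1) : (b * y) * Θ (b * y) < b * (y * Θ y) := by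
  have h0 : 0 < b * y := by positivity
  have := theta_lt_theta hmono h0 (show b * y < y by nlinarith)
  calc (b * y) * Θ (b * y) < (b * y) * Θ y := by gcongr
    _ = _ := by ring

/-- Under the standing assumptions on `Θ`, the function `x Θ(x)` is an Orlicz function which is
moreover strictly convex, continuous and of superlinear growth. -/
theorem exists_orliczFunction_mul_theta (hmono : StrictMono fun r : ℝ => Θ (Real.exp r))
    (hconv : ConvexOn ℝ univ fun r : ℝ => Θ (Real.exp r))
    (htop : Tendsto (fun r : ℝ => Θ (Real.exp r)) atTop atTop)
    (hbot : Tendsto (fun r : ℝ => Θ (Real.exp r)) atBot (𝓝 0)) :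
    ∃ U : OrliczFunction, (∀ x : ℝ≥0, (U x : ℝ) = x * Θ x) ∧ StrictConvexOn ℝ≥0 univ U ∧
      Continuous U ∧ ∀ B : ℝ≥0, ∃ R : ℝ≥0, ∀ x, R ≤ x → B * x ≤ U x := by
  have hnn : ∀ x : ℝ≥0, 0 ≤ (x : ℝ) * Θ x := by
    intro x
    rcases eq_or_ne x 0 with rfl | hx
    · simp
    · exact mul_nonneg x.2 (theta_pos hmono hbot (by positivity)).le
  let U : ℝ≥0 → ℝ≥0 := fun x => ⟨x * Θ x, hnn x⟩
  have hU : ∀ x : ℝ≥0, (U x : ℝ) = x * Θ x := fun _ => rfl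
  have hstrict : StrictConvexOn ℝ≥0 univ U := by
    refine ⟨convex_univ, fun x _ y _ hxy a b ha hb hab => ?_⟩
    have ha' : 0 < (a : ℝ) := ha
    have hb' : 0 < (b : ℝ) := hb
    have hab' : (a : ℝ) + b = 1 := by exact_mod_cast hab
    rw [← NNReal.coe_lt_coe]
    simp only [smul_eq_mul, NNReal.coe_add, NNReal.coe_mul, hU]
    rcases eq_or_ne x 0 with rfl | hx
    · have hy : 0 < (y : ℝ) := by
        have := hxy.symm; positivity
      simpa using mul_theta_smul_lt hmono hy hb' (by linarith)
    rcases eq_or_ne y 0 with rfl | hy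
    · have hx : 0 < (x : ℝ) := by positivity
      simpa using mul_theta_smul_lt hmono hx ha' (by linarith)
    exact mul_theta_combo_lt hmono hconv (by positivity) (by positivity)
      (fun h => hxy (NNReal.coe_injective h)) ha' hb' hab'
  have hgrow : ∀ B : ℝ≥0, ∃ R : ℝ≥0, ∀ x, R ≤ x → B * x ≤ U x := by
    intro B
    obtain ⟨R, hR⟩ := eventually_atTop.mp ((tendsto_theta_atTop htop).eventually_ge_atTop (B : ℝ))
    refine ⟨max 1 R.toNNReal, fun x hx => ?_⟩
    rw [← NNReal.coe_le_coe, NNReal.coe_mul, hU, mul_comm]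
    gcongr
    exact hR _ ((Real.le_coe_toNNReal R).trans (by exact_mod_cast (le_max_right _ _).trans hx))
  have htend : Tendsto U atTop atTop := by
    obtain ⟨R, hR⟩ := hgrow 1
    refine tendsto_atTop_mono' _ ?_ tendsto_id
    filter_upwards [eventually_ge_atTop R] with x hx
    simpa using hR x hx
  refine ⟨⟨U, by ext; simp [hU], hstrict.convexOn, htend⟩, hU, hstrict, ?_, hgrow⟩
  change Continuous U
  rw [continuous_iff_continuousAt]
  intro x
  rw [ContinuousAt, ← NNReal.tendsto_coe]
  simp only [hU]
  rcases eq_or_ne x 0 with rfl | hx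
  · have hle : ∀ᶠ y : ℝ≥0 in 𝓝 0, (y : ℝ) * Θ y ≤ y * Θ 1 := by
      filter_upwards [Iio_mem_nhds (zero_lt_one (α := ℝ≥0))] with y hy
      rcases eq_or_ne y 0 with rfl | hy0
      · simp
      · have : (y : ℝ) < 1 := by exact_mod_cast hy
        exact mul_le_mul_of_nonneg_left (theta_le_theta hmono (by positivity) this.le) y.2
    have h0 : Tendsto (fun y : ℝ≥0 => (y : ℝ) * Θ 1) (𝓝 0) (𝓝 (((0 : ℝ≥0) : ℝ) * Θ 1)) :=
      (NNReal.continuous_coe.tendsto 0).mul_const _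
    simp only [NNReal.coe_zero, zero_mul] at h0 ⊢
    exact tendsto_of_tendsto_of_tendsto_of_le_of_le' tendsto_const_nhds h0
      (Eventually.of_forall hnn) hle
  · have hc : ContinuousAt Θ x :=
      (continuousOn_theta hconv).continuousAt (Ioi_mem_nhds (by positivity))
    exact (NNReal.continuous_coe.tendsto x).mul (hc.tendsto.comp (NNReal.continuous_coe.tendsto x))

end InternalEnergyFunction

/-! ### Weak compactness in Banach spaces -/

section WeakCompactness

variable {X : Type*} [NormedAddCommGroup X] [NormedSpace ℝ X]

theorem tendsto_weakSpace_iff {ι : Type*} {l : Filter ι} {u : ι → X} {x : X} :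
    Tendsto (fun i => toWeakSpace ℝ X (u i)) l (𝓝 (toWeakSpace ℝ X x)) ↔
      ∀ φ : StrongDual ℝ X, Tendsto (fun i => φ (u i)) l (𝓝 (φ x)) :=
  WeakBilin.tendsto_iff_forall_eval_tendsto _ (separatingDual_iff_injective.mp inferInstance)

theorem continuous_dual_comp_toWeakSpace_symm (φ : StrongDual ℝ X) :
    Continuous fun x : WeakSpace ℝ X => φ ((toWeakSpace ℝ X).symm x) :=
  WeakBilin.eval_continuous (topDualPairing ℝ X).flip φ

/-- The norm is weakly lower semicontinuous. -/
theorem norm_sub_le_of_tendsto_dual {ι : Type*} {l : Filter ι} [l.NeBot] {u v : ι → X} {x y : X}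
    {r : ℝ} (hr : 0 ≤ r) (hu : ∀ φ : StrongDual ℝ X, Tendsto (fun i => φ (u i)) l (𝓝 (φ x)))
    (hv : ∀ φ : StrongDual ℝ X, Tendsto (fun i => φ (v i)) l (𝓝 (φ y)))
    (h : ∀ᶠ i in l, ‖u i - v i‖ ≤ r) : ‖x - y‖ ≤ r := by
  refine NormedSpace.norm_le_dual_bound ℝ _ hr fun φ => ?_
  have h1 : Tendsto (fun i => ‖φ (u i) - φ (v i)‖) l (𝓝 ‖φ x - φ y‖) := ((hu φ).sub (hv φ)).norm
  rw [map_sub]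
  refine le_of_tendsto h1 ?_
  filter_upwards [h] with i hi
  rw [← map_sub, mul_comm]
  exact (φ.le_opNorm _).trans (by gcongr)

/-- **Grothendieck's criterion**: a weakly closed subset `A` of a Banach space which is contained,
up to an arbitrarily small error in norm, in weakly compact sets is itself weakly compact.
Along an ultrafilter on `A`, the approximating points converge weakly, their limits form a Cauchy
sequence, and its norm limit is the weak limit of the ultrafilter. -/
theorem isCompact_weak_of_approx [CompleteSpace X] {A : Set X} (T : ℕ → X → X)
    (S : ℕ → Set X) (ε : ℕ → ℝ) (hε : Tendsto ε atTop (𝓝 0))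
    (hS : ∀ n, IsCompact (toWeakSpace ℝ X '' S n)) (hT : ∀ n, ∀ x ∈ A, T n x ∈ S n)
    (hTε : ∀ n, ∀ x ∈ A, ‖T n x - x‖ ≤ ε n) (hA : IsClosed (toWeakSpace ℝ X '' A)) :
    IsCompact (toWeakSpace ℝ X '' A) := by
  rcases A.eq_empty_or_nonempty with rfl | ⟨a₀, ha₀⟩
  · simp
  have hε0 : ∀ n, 0 ≤ ε n := fun n => (norm_nonneg _).trans (hTε n a₀ ha₀)
  rw [isCompact_iff_ultrafilter_le_nhds']
  intro F hF
  set G : Ultrafilter X := F.map (toWeakSpace ℝ X).symm with hG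
  have hAG : ∀ᶠ x in (G : Filter X), x ∈ A := by
    rw [hG, Ultrafilter.coe_map, eventually_map]
    filter_upwards [hF] with w hw
    obtain ⟨x, hx, rfl⟩ := hw
    simpa using hx
  have hlim : ∀ n, ∃ y : X, ∀ φ : StrongDual ℝ X,
      Tendsto (fun x => φ (T n x)) (G : Filter X) (𝓝 (φ y)) := by
    intro n
    have hmem : toWeakSpace ℝ X '' S n ∈ G.map (fun x => toWeakSpace ℝ X (T n x)) := by
      rw [Ultrafilter.mem_map]
      filter_upwards [hAG] with x hx
      exact mem_image_of_mem _ (hT n x hx)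
    obtain ⟨w, ⟨y, -, rfl⟩, hy⟩ := isCompact_iff_ultrafilter_le_nhds'.mp (hS n) _ hmem
    exact ⟨y, tendsto_weakSpace_iff.mp hy⟩
  choose y hy using hlim
  have hdist : ∀ n k, ‖y n - y k‖ ≤ ε n + ε k := by
    intro n k
    refine norm_sub_le_of_tendsto_dual (add_nonneg (hε0 n) (hε0 k)) (hy n) (hy k) ?_
    filter_upwards [hAG] with x hx
    calc ‖T n x - T k x‖ = ‖(T n x - x) - (T k x - x)‖ := by congr 1; abel
      _ ≤ ‖T n x - x‖ + ‖T k x - x‖ := norm_sub_le _ _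
      _ ≤ _ := add_le_add (hTε n x hx) (hTε k x hx)
  have hcauchy : CauchySeq y := by
    rw [Metric.cauchySeq_iff']
    intro δ hδ
    obtain ⟨N, hN⟩ := eventually_atTop.mp (hε.eventually (Iio_mem_nhds (half_pos hδ)))
    refine ⟨N, fun n hn => ?_⟩
    rw [dist_eq_norm]
    have h1 : ε n < δ / 2 := hN n hn
    have h2 : ε N < δ / 2 := hN N le_rfl
    exact (hdist n N).trans_lt (by linarith)
  obtain ⟨z, hz⟩ := cauchySeq_tendsto_of_complete hcauchy
  have hGz : ∀ φ : StrongDual ℝ X, Tendsto (fun x => φ x) (G : Filter X) (𝓝 (φ z)) := by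
    intro φ
    rw [Metric.tendsto_nhds]
    intro δ hδ
    have h1 : Tendsto (fun n => ‖φ‖ * ε n + ‖φ‖ * ‖y n - z‖) atTop (𝓝 0) := by
      have := (hε.const_mul ‖φ‖).add ((tendsto_iff_norm_sub_tendsto_zero.mp hz).const_mul ‖φ‖)
      simpa using this
    obtain ⟨n, hn⟩ := (h1.eventually (Iio_mem_nhds (half_pos hδ))).exists
    filter_upwards [hAG, Metric.tendsto_nhds.mp (hy n φ) (δ / 2) (half_pos hδ)] with x hx hx2
    rw [Real.dist_eq, ← Real.norm_eq_abs] at hx2 ⊢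
    have hn' : ‖φ‖ * ε n + ‖φ‖ * ‖y n - z‖ < δ / 2 := hn
    have e1 : ‖φ (T n x - x)‖ ≤ ‖φ‖ * ε n :=
      (φ.le_opNorm _).trans (mul_le_mul_of_nonneg_left (hTε n x hx) (norm_nonneg _))
    have e2 : ‖φ (y n - z)‖ ≤ ‖φ‖ * ‖y n - z‖ := φ.le_opNorm _
    calc ‖φ x - φ z‖ = ‖-φ (T n x - x) + (φ (T n x) - φ (y n)) + φ (y n - z)‖ := by
          simp only [map_sub]; congr 1; ring
      _ ≤ ‖φ (T n x - x)‖ + ‖φ (T n x) - φ (y n)‖ + ‖φ (y n - z)‖ := by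
          refine (norm_add_le _ _).trans ?_
          gcongr
          exact (norm_add_le _ _).trans (by rw [norm_neg])
      _ < δ := by linarith
  have hFz : (F : Filter (WeakSpace ℝ X)) ≤ 𝓝 (toWeakSpace ℝ X z) := by
    have h1 := tendsto_weakSpace_iff.mpr hGz
    rw [hG, Ultrafilter.coe_map, tendsto_map'_iff] at h1
    exact (tendsto_id'.mp (h1.congr fun w => by simp))
  exact ⟨_, hA.mem_of_tendsto (tendsto_id'.mpr hFz) hF, hFz⟩

/-- In a separable normed space, countably many continuous functionals separate points, so weakly
compact sets are weakly metrizable, hence weakly sequentially compact. -/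
theorem isSeqCompact_weak_of_isCompact [TopologicalSpace.SeparableSpace X] {A : Set (WeakSpace ℝ X)}
    (hA : IsCompact A) : IsSeqCompact A := by
  have hdual : ∀ x : X, ∃ φ : StrongDual ℝ X, ‖φ‖ ≤ 1 ∧ φ x = ‖x‖ := fun x =>
    exists_dual_vector'' ℝ x
  -- The norming functionals of a dense sequence separate points.
  choose D hD1 hD2 using hdual
  have hsep : ∀ x y : X, x ≠ y → ∃ n, D (TopologicalSpace.denseSeq X n) x ≠
      D (TopologicalSpace.denseSeq X n) y := by
    intro x y hxy
    by_contra! h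
    have hpos : 0 < ‖x - y‖ := norm_pos_iff.mpr (sub_ne_zero.mpr hxy)
    obtain ⟨_, ⟨n, rfl⟩, hn⟩ := (TopologicalSpace.denseRange_denseSeq X).exists_dist_lt (x - y)
      (half_pos hpos) |>.imp fun a h => (⟨⟨a, rfl⟩, h⟩ : (∃ n, n = a) ∧ _)
    set e := TopologicalSpace.denseSeq X n
    rw [dist_eq_norm] at hn
    have h1 : D e (x - y) = 0 := by rw [map_sub, h n, sub_self]
    have h2 : ‖e‖ ≤ ‖x - y - e‖ := by
      have : D e (x - y - e) = -‖e‖ := by rw [map_sub, h1, hD2]; simp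
      calc ‖e‖ = ‖D e (x - y - e)‖ := by rw [this]; simp
        _ ≤ ‖D e‖ * ‖x - y - e‖ := (D e).le_opNorm _
        _ ≤ 1 * ‖x - y - e‖ := by gcongr; exact hD1 _
        _ = _ := one_mul _
    have h3 : ‖x - y‖ ≤ ‖x - y - e‖ + ‖e‖ := by simpa using norm_add_le (x - y - e) e
    linarith
  have hcpt : CompactSpace A := isCompact_iff_compactSpace.mp hA
  have hmet : TopologicalSpace.MetrizableSpace A :=
    Metric.PiNatEmbed.TopologicalSpace.MetrizableSpace.of_countable_separating
      (fun n (k : A) => D (TopologicalSpace.denseSeq X n) ((toWeakSpace ℝ X).symm k))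
      (fun n => (continuous_dual_comp_toWeakSpace_symm _).comp continuous_subtype_val)
      fun x y hxy => hsep _ _ fun h =>
        hxy (Subtype.ext ((toWeakSpace ℝ X).symm.injective h))
  have hcont : SeqContinuous (fun w : A => (w : WeakSpace ℝ X)) :=
    continuous_iff_seqContinuous.mp continuous_subtype_val
  simpa using IsSeqCompact.range hcont

/-- Bounded linear images of closed balls of a real Hilbert space are weakly compact. -/
theorem isCompact_weak_image_closedBall {H : Type*} [NormedAddCommGroup H] [InnerProductSpace ℝ H]
    [CompleteSpace H] (T : H →L[ℝ] X) (r : ℝ) :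
    IsCompact (toWeakSpace ℝ X '' (T '' Metric.closedBall 0 r)) := by
  -- The Riesz isomorphism turns the Banach–Alaoglu theorem into weak compactness of balls of `H`.
  let R : WeakDual ℝ H → WeakSpace ℝ X := fun ψ =>
    toWeakSpace ℝ X (T ((InnerProductSpace.toDual ℝ H).symm (WeakDual.toStrongDual ψ)))
  have hR : Continuous R := by
    refine WeakBilin.continuous_of_continuous_eval _ fun φ => ?_
    have : ∀ ψ : WeakDual ℝ H,
        φ (T ((InnerProductSpace.toDual ℝ H).symm (WeakDual.toStrongDual ψ))) =
          ψ ((InnerProductSpace.toDual ℝ H).symm (φ.comp T)) := by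
      intro ψ
      have h1 := InnerProductSpace.toDual_symm_apply (𝕜 := ℝ)
        (x := (InnerProductSpace.toDual ℝ H).symm (WeakDual.toStrongDual ψ)) (y := φ.comp T)
      have h2 := InnerProductSpace.toDual_symm_apply (𝕜 := ℝ)
        (x := (InnerProductSpace.toDual ℝ H).symm (φ.comp T)) (y := WeakDual.toStrongDual ψ)
      rw [real_inner_comm] at h1
      exact h1.symm.trans h2
    change Continuous fun ψ : WeakDual ℝ H =>
      φ (T ((InnerProductSpace.toDual ℝ H).symm (WeakDual.toStrongDual ψ)))
    simp only [this]
    exact WeakDual.eval_continuous _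
  convert (WeakDual.isCompact_closedBall (𝕜 := ℝ) (0 : StrongDual ℝ H) r).image hR using 1
  ext w
  constructor
  · rintro ⟨_, ⟨h, hh, rfl⟩, rfl⟩
    refine ⟨StrongDual.toWeakDual (InnerProductSpace.toDual ℝ H h), ?_, ?_⟩
    · simpa using hh
    · simp [R]
  · rintro ⟨ψ, hψ, rfl⟩
    refine ⟨_, ⟨(InnerProductSpace.toDual ℝ H).symm (WeakDual.toStrongDual ψ), ?_, rfl⟩, rfl⟩
    simpa using hψ

end WeakCompactness

/-! ### Lower semicontinuity along sequences -/

section LowerSemicontinuity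

/-- In a first countable space, lower semicontinuity is tested on sequences in sublevel sets. -/
theorem lowerSemicontinuousOn_of_seq {X : Type*} [TopologicalSpace X] [FirstCountableTopology X]
    {F : X → ℝ≥0∞} {P : Set X}
    (h : ∀ (u : ℕ → X) (x : X) (c : ℝ≥0∞), (∀ n, u n ∈ P) → x ∈ P → Tendsto u atTop (𝓝 x) →
      (∀ n, F (u n) ≤ c) → F x ≤ c) : LowerSemicontinuousOn F P := by
  intro x hx c hc
  by_contra hcon
  rw [not_eventually] at hcon
  obtain ⟨u, hu, hu2⟩ := exists_seq_forall_of_frequently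
    (hcon.and_eventually eventually_mem_nhdsWithin)
  refine absurd hc (not_lt.mpr (h u x c (fun n => (hu2 n).2) hx ?_ fun n => not_lt.mp (hu2 n).1))
  exact hu.mono_right nhdsWithin_le_nhds

end LowerSemicontinuity

/-! ### Probability densities -/

section Densities

variable {M : Type*} [MeasurableSpace M] {m : Measure M}

theorem aemeasurable_ofReal_coe (ρ : Lp ℝ 1 m) : AEMeasurable (fun x => ENNReal.ofReal (ρ x)) m :=
  (Lp.aestronglyMeasurable ρ).aemeasurable.ennreal_ofReal

theorem integrable_coe (ρ : Lp ℝ 1 m) : Integrable ρ m := L1.integrable_coeFn ρ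

theorem isProbabilityMeasure_densityMeasure {ρ : Lp ℝ 1 m} (hρ : IsProbDensity m ρ) :
    IsProbabilityMeasure (densityMeasure m ρ) := by
  refine ⟨?_⟩
  rw [densityMeasure, withDensity_apply _ MeasurableSet.univ, Measure.restrict_univ,
    ← ofReal_integral_eq_lintegral_ofReal (integrable_coe ρ) hρ.1, hρ.2, ENNReal.ofReal_one]

/-- The measure `ρ dm` of a probability density `ρ`, bundled as a probability measure. -/
noncomputable def densityProbabilityMeasure {ρ : Lp ℝ 1 m} (hρ : IsProbDensity m ρ) :
    ProbabilityMeasure M :=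
  ⟨densityMeasure m ρ, isProbabilityMeasure_densityMeasure hρ⟩

theorem coe_densityProbabilityMeasure {ρ : Lp ℝ 1 m} (hρ : IsProbDensity m ρ) :
    (densityProbabilityMeasure hρ : Measure M) = densityMeasure m ρ := rfl

theorem coe_combo_ae (a b : ℝ) (ρ σ : Lp ℝ 1 m) :
    (a • ρ + b • σ : Lp ℝ 1 m) =ᵐ[m] fun x => a * ρ x + b * σ x := by
  filter_upwards [Lp.coeFn_add (a • ρ) (b • σ), Lp.coeFn_smul a ρ, Lp.coeFn_smul b σ]
    with x h1 h2 h3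
  rw [h1, Pi.add_apply, h2, h3]
  rfl

theorem IsProbDensity.combo {ρ σ : Lp ℝ 1 m} (hρ : IsProbDensity m ρ) (hσ : IsProbDensity m σ)
    {a b : ℝ} (ha : 0 ≤ a) (hb : 0 ≤ b) (hab : a + b = 1) :
    IsProbDensity m (a • ρ + b • σ) := by
  constructor
  · filter_upwards [coe_combo_ae a b ρ σ, hρ.1, hσ.1] with x h1 h2 h3
    rw [h1]; positivity
  · rw [integral_congr_ae (coe_combo_ae a b ρ σ), integral_add ((integrable_coe ρ).const_mul a)
      ((integrable_coe σ).const_mul b), integral_const_mul, integral_const_mul, hρ.2, hσ.2]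
    linarith

theorem densityMeasure_combo {ρ σ : Lp ℝ 1 m} (hρ : IsProbDensity m ρ) (hσ : IsProbDensity m σ)
    {a b : ℝ} (ha : 0 ≤ a) (hb : 0 ≤ b) :
    densityMeasure m (a • ρ + b • σ) =
      ENNReal.ofReal a • densityMeasure m ρ + ENNReal.ofReal b • densityMeasure m σ := by
  ext s hs
  simp only [densityMeasure, Measure.add_apply, Measure.smul_apply, withDensity_apply _ hs,
    smul_eq_mul]
  rw [← lintegral_const_mul' _ _ ENNReal.ofReal_ne_top,
    ← lintegral_const_mul' _ _ ENNReal.ofReal_ne_top,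
    ← lintegral_add_left' ((aemeasurable_ofReal_coe ρ).restrict.const_mul _)]
  refine lintegral_congr_ae (ae_restrict_of_ae ?_)
  filter_upwards [coe_combo_ae a b ρ σ, hρ.1, hσ.1] with x h1 h2 h3
  rw [h1, ENNReal.ofReal_add (mul_nonneg ha h2) (mul_nonneg hb h3), ENNReal.ofReal_mul ha,
    ENNReal.ofReal_mul hb]

theorem integral_densityMeasure {ρ : Lp ℝ 1 m} (hρ : IsProbDensity m ρ) (h : M → ℝ) :
    ∫ x, h x ∂densityMeasure m ρ = ∫ x, ρ x * h x ∂m := by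
  rw [densityMeasure, integral_withDensity_eq_integral_toReal_smul₀ (aemeasurable_ofReal_coe ρ)
    (by simp)]
  refine integral_congr_ae ?_
  filter_upwards [hρ.1] with x hx
  rw [ENNReal.toReal_ofReal hx, smul_eq_mul]

/-- The pairing of `L¹` with a bounded measurable function, as a continuous linear functional. -/
theorem exists_dual_eq_integral_mul (h : M → ℝ) (hm : AEStronglyMeasurable h m) (B : ℝ)
    (hB : ∀ x, ‖h x‖ ≤ B) :
    ∃ φ : StrongDual ℝ (Lp ℝ 1 m), ∀ ρ, φ ρ = ∫ x, ρ x * h x ∂m := by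
  have hint : ∀ ρ : Lp ℝ 1 m, Integrable (fun x => ρ x * h x) m := fun ρ =>
    (integrable_coe ρ).mul_bdd hm (Eventually.of_forall hB)
  refine ⟨LinearMap.mkContinuous
    { toFun := fun ρ => ∫ x, ρ x * h x ∂m
      map_add' := fun ρ σ => ?_
      map_smul' := fun c ρ => ?_ } B fun ρ => ?_, fun ρ => rfl⟩
  · rw [← integral_add (hint ρ) (hint σ)]
    refine integral_congr_ae ?_
    filter_upwards [Lp.coeFn_add ρ σ] with x hx
    rw [hx, Pi.add_apply, add_mul]
  · rw [RingHom.id_apply, smul_eq_mul, ← integral_const_mul]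
    refine integral_congr_ae ?_
    filter_upwards [Lp.coeFn_smul c ρ] with x hx
    rw [hx, Pi.smul_apply, smul_eq_mul, mul_assoc]
  · change ‖∫ x, ρ x * h x ∂m‖ ≤ B * ‖ρ‖
    rw [L1.norm_eq_integral_norm, ← integral_const_mul]
    refine norm_integral_le_of_norm_le ((integrable_coe ρ).norm.const_mul B)
      (Eventually.of_forall fun x => ?_)
    rw [norm_mul, mul_comm]
    exact mul_le_mul_of_nonneg_right (hB x) (norm_nonneg _)

theorem isClosed_setOf_isProbDensity [IsFiniteMeasure m] :
    IsClosed {ρ : Lp ℝ 1 m | IsProbDensity m ρ} := by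
  have h1 : IsClosed {ρ : Lp ℝ 1 m | 0 ≤ ρ} := isClosed_Ici
  have h2 : IsClosed {ρ : Lp ℝ 1 m | ∫ x, ρ x ∂m = 1} :=
    isClosed_eq continuous_integral continuous_const
  convert h1.inter h2 using 1
  ext ρ
  exact and_congr_left fun _ => Lp.coeFn_nonneg ρ

end Densities

/-! ### The transport cost -/

section Wasserstein

variable {M : Type*} [MetricSpace M] [MeasurableSpace M]

theorem wassersteinSq_combo_le (μ₁ μ₂ ν : Measure M) [IsProbabilityMeasure ν] {a b : ℝ≥0∞}
    (ha : a ≠ 0) (hb : b ≠ 0) (hab : a + b = 1) :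
    wassersteinSq (a • μ₁ + b • μ₂) ν ≤ a * wassersteinSq μ₁ ν + b * wassersteinSq μ₂ ν := by
  have ha' : a ≠ ⊤ := by rintro rfl; simp at hab
  have hb' : b ≠ ⊤ := by rintro rfl; simp at hab
  have e : ∀ μ : Measure M, wassersteinSq μ ν = ⨅ π : {π : Measure (M × M) //
      IsProbabilityMeasure π ∧ π.map Prod.fst = μ ∧ π.map Prod.snd = ν},
      ∫⁻ z, edist z.1 z.2 ^ 2 / 2 ∂π.1 := fun μ => iInf_subtype'
  rw [e μ₁, e μ₂, ENNReal.mul_iInf_of_ne ha ha', ENNReal.mul_iInf_of_ne hb hb']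
  refine ENNReal.le_iInf_add_iInf ?_
  rintro ⟨π₁, h₁, h₁f, h₁s⟩ ⟨π₂, h₂, h₂f, h₂s⟩
  refine (iInf₂_le (a • π₁ + b • π₂) ⟨⟨?_⟩, ?_, ?_⟩).trans (le_of_eq ?_)
  · rw [lintegral_add_measure, lintegral_smul_measure, lintegral_smul_measure, smul_eq_mul,
      smul_eq_mul]
  · simp [hab]
  · rw [Measure.map_add _ _ measurable_fst, Measure.map_smul, Measure.map_smul, h₁f, h₂f]
  · rw [Measure.map_add _ _ measurable_snd, Measure.map_smul, Measure.map_smul, h₁s, h₂s,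
      ← add_smul, hab, one_smul]


/-- The half squared distance as a bounded continuous function on the compact space `M × M`. -/
noncomputable def halfDistSq (M : Type*) [MetricSpace M] [CompactSpace M] :
    BoundedContinuousFunction (M × M) ℝ≥0 :=
  BoundedContinuousFunction.mkOfCompact ⟨fun z => nndist z.1 z.2 ^ 2 / 2, by fun_prop⟩

theorem coe_halfDistSq {M : Type*} [MetricSpace M] [CompactSpace M] (z : M × M) :
    ((halfDistSq M z : ℝ≥0) : ℝ≥0∞) = edist z.1 z.2 ^ 2 / 2 := by
  have : halfDistSq M z = nndist z.1 z.2 ^ 2 / 2 := rfl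
  rw [this, ENNReal.coe_div two_ne_zero, ENNReal.coe_pow, edist_nndist]
  rfl

variable [BorelSpace M]

theorem tendsto_densityProbabilityMeasure {m : Measure M} [IsFiniteMeasure m] {ρ : ℕ → Lp ℝ 1 m}
    {ρ₀ : Lp ℝ 1 m} (hρ : ∀ n, IsProbDensity m (ρ n)) (hρ₀ : IsProbDensity m ρ₀)
    (h : Tendsto ρ atTop (𝓝 ρ₀)) :
    Tendsto (fun n => densityProbabilityMeasure (hρ n)) atTop
      (𝓝 (densityProbabilityMeasure hρ₀)) := by
  rw [ProbabilityMeasure.tendsto_iff_forall_integral_tendsto]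
  intro g
  obtain ⟨φ, hφ⟩ := exists_dual_eq_integral_mul (m := m) g g.continuous.aestronglyMeasurable ‖g‖
    g.norm_coe_le_norm
  simp only [coe_densityProbabilityMeasure, integral_densityMeasure, hρ, hρ₀, ← hφ]
  exact (φ.continuous.tendsto ρ₀).comp h

variable [CompactSpace M]

theorem wassersteinSq_self (μ : Measure M) [IsProbabilityMeasure μ] : wassersteinSq μ μ = 0 := by
  have hd : Measurable fun x : M => (x, x) := measurable_id.prodMk measurable_id
  refine le_antisymm ((iInf₂_le (μ.map fun x => (x, x)) ⟨?_, ?_, ?_⟩).trans ?_) zero_le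
  · rw [lintegral_map (by fun_prop) hd]
    simp
  · exact Measure.isProbabilityMeasure_map hd.aemeasurable
  · rw [Measure.map_map measurable_fst hd]; exact Measure.map_id
  · rw [Measure.map_map measurable_snd hd]; exact Measure.map_id

/-- Lower semicontinuity of the transport cost: by compactness of the space of probability
measures on `M × M`, nearly optimal plans accumulate at a plan for the limit. -/
theorem wassersteinSq_le_of_tendsto {μ : ℕ → ProbabilityMeasure M} {μ₀ : ProbabilityMeasure M}
    {ν : Measure M} [IsProbabilityMeasure ν] (hμ : Tendsto μ atTop (𝓝 μ₀)) {c : ℝ≥0∞}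
    (hc : ∀ n, wassersteinSq (μ n : Measure M) ν ≤ c) : wassersteinSq (μ₀ : Measure M) ν ≤ c := by
  refine le_of_forall_gt_imp_ge_of_dense fun d hd => ?_
  have hex : ∀ n, ∃ π : ProbabilityMeasure (M × M), (π : Measure (M × M)).map Prod.fst = μ n ∧
      (π : Measure (M × M)).map Prod.snd = ν ∧
      ∫⁻ z, edist z.1 z.2 ^ 2 / 2 ∂(π : Measure (M × M)) ≤ d := by
    intro n
    have := (hc n).trans_lt hd
    rw [wassersteinSq] at this
    simp only [iInf_lt_iff] at this
    obtain ⟨π, ⟨h1, h2, h3⟩, h4⟩ := this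
    exact ⟨⟨π, h1⟩, h2, h3, h4.le⟩
  choose π hπ1 hπ2 hπ3 using hex
  obtain ⟨π₀, -, hπ₀⟩ := isCompact_iff_ultrafilter_le_nhds'.mp
    (isCompact_univ (X := ProbabilityMeasure (M × M))) ((hyperfilter ℕ).map π) univ_mem
  have ht : Tendsto π (hyperfilter ℕ) (𝓝 π₀) := hπ₀
  have hle : (hyperfilter ℕ : Filter ℕ) ≤ atTop := by
    rw [← Nat.cofinite_eq_atTop]; exact hyperfilter_le_cofinite
  have hfst : π₀.map continuous_fst.aemeasurable = μ₀ := by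
    refine tendsto_nhds_unique (((ProbabilityMeasure.continuous_map continuous_fst).tendsto
      π₀).comp ht) ((hμ.mono_left hle).congr fun n => ?_)
    exact Subtype.ext (hπ1 n).symm
  have hsnd : π₀.map continuous_snd.aemeasurable = ⟨ν, inferInstance⟩ := by
    refine tendsto_nhds_unique (((ProbabilityMeasure.continuous_map continuous_snd).tendsto
      π₀).comp ht) (tendsto_const_nhds.congr fun n => ?_)
    exact Subtype.ext (hπ2 n).symm
  refine (iInf₂_le (π₀ : Measure (M × M)) ⟨inferInstance, ?_, ?_⟩).trans ?_
  · have h1 := ProbabilityMeasure.tendsto_iff_forall_lintegral_tendsto.mp ht (halfDistSq M)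
    simp only [coe_halfDistSq] at h1
    exact le_of_tendsto h1 (Eventually.of_forall hπ3)
  · exact congrArg Subtype.val hfst
  · exact congrArg Subtype.val hsnd

theorem lowerSemicontinuousOn_wassersteinSq {m : Measure M} [IsFiniteMeasure m] {ν : Measure M}
    [IsProbabilityMeasure ν] :
    LowerSemicontinuousOn (fun ρ : Lp ℝ 1 m => wassersteinSq (densityMeasure m ρ) ν)
      {ρ | IsProbDensity m ρ} := by
  refine lowerSemicontinuousOn_of_seq fun u x c hu hx hlim hc => ?_
  exact wassersteinSq_le_of_tendsto (tendsto_densityProbabilityMeasure hu hx hlim) hc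

end Wasserstein

/-! ### The internal energy -/

section InternalEnergy

variable {M : Type*} [MeasurableSpace M] {m : Measure M} {Θ : ℝ → ℝ} {U : OrliczFunction}

theorem internalEnergy_eq_modular (hU : ∀ x : ℝ≥0, (U x : ℝ) = x * Θ x) {ρ : Lp ℝ 1 m}
    (hρ : ∀ᵐ x ∂m, 0 ≤ ρ x) : internalEnergy Θ m ρ = U.modular m (ρ : M →ₘ[m] ℝ) := by
  refine lintegral_congr_ae ?_
  filter_upwards [hρ] with x hx
  have h := hU ‖ρ x‖₊
  rw [coe_nnnorm, Real.norm_of_nonneg hx] at h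
  rw [← h, ENNReal.ofReal_coe_nnreal]

theorem aemeasurable_orlicz_comp (ρ : Lp ℝ 1 m) :
    AEMeasurable (fun x => (U ‖ρ x‖₊ : ℝ≥0∞)) m :=
  U.aemeasurable_modular (ρ : M →ₘ[m] ℝ)

theorem nnnorm_combo_ae {ρ σ : Lp ℝ 1 m} (hρ : ∀ᵐ x ∂m, 0 ≤ ρ x) (hσ : ∀ᵐ x ∂m, 0 ≤ σ x)
    (a b : ℝ≥0) :
    ∀ᵐ x ∂m, ‖((a : ℝ) • ρ + (b : ℝ) • σ : Lp ℝ 1 m) x‖₊ = a * ‖ρ x‖₊ + b * ‖σ x‖₊ := by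
  filter_upwards [coe_combo_ae (a : ℝ) b ρ σ, hρ, hσ] with x h1 h2 h3
  rw [h1, ← NNReal.coe_inj, coe_nnnorm, NNReal.coe_add, NNReal.coe_mul, NNReal.coe_mul, coe_nnnorm,
    coe_nnnorm, Real.norm_of_nonneg h2, Real.norm_of_nonneg h3, Real.norm_of_nonneg]
  have := a.2; have := b.2; positivity

theorem lintegral_orlicz_combo (a b : ℝ≥0) (ρ σ : Lp ℝ 1 m) :
    ∫⁻ x, ((a * U ‖ρ x‖₊ + b * U ‖σ x‖₊ : ℝ≥0) : ℝ≥0∞) ∂m =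
      a * U.modular m (ρ : M →ₘ[m] ℝ) + b * U.modular m (σ : M →ₘ[m] ℝ) := by
  simp only [ENNReal.coe_add, ENNReal.coe_mul]
  rw [lintegral_add_left' ((aemeasurable_orlicz_comp ρ).const_mul _),
    lintegral_const_mul' _ _ ENNReal.coe_ne_top, lintegral_const_mul' _ _ ENNReal.coe_ne_top]
  rfl

theorem modular_combo_le {ρ σ : Lp ℝ 1 m} (hρ : ∀ᵐ x ∂m, 0 ≤ ρ x) (hσ : ∀ᵐ x ∂m, 0 ≤ σ x)
    {a b : ℝ≥0} (hab : a + b = 1) :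
    U.modular m (((a : ℝ) • ρ + (b : ℝ) • σ : Lp ℝ 1 m) : M →ₘ[m] ℝ) ≤
      a * U.modular m (ρ : M →ₘ[m] ℝ) + b * U.modular m (σ : M →ₘ[m] ℝ) := by
  rw [← lintegral_orlicz_combo]
  refine lintegral_mono_ae ?_
  filter_upwards [nnnorm_combo_ae hρ hσ a b] with x hx
  rw [hx]
  exact_mod_cast U.map_combo_le hab _ _

theorem modular_combo_lt (hstrict : StrictConvexOn ℝ≥0 univ U) {ρ σ : Lp ℝ 1 m}
    (hρ : ∀ᵐ x ∂m, 0 ≤ ρ x) (hσ : ∀ᵐ x ∂m, 0 ≤ σ x) (hne : ρ ≠ σ)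
    (hρU : U.modular m (ρ : M →ₘ[m] ℝ) ≠ ⊤) (hσU : U.modular m (σ : M →ₘ[m] ℝ) ≠ ⊤)
    {a b : ℝ≥0} (ha : 0 < a) (hb : 0 < b) (hab : a + b = 1) :
    U.modular m (((a : ℝ) • ρ + (b : ℝ) • σ : Lp ℝ 1 m) : M →ₘ[m] ℝ) <
      a * U.modular m (ρ : M →ₘ[m] ℝ) + b * U.modular m (σ : M →ₘ[m] ℝ) := by
  have hle := modular_combo_le (U := U) hρ hσ hab
  have hfin : a * U.modular m (ρ : M →ₘ[m] ℝ) + b * U.modular m (σ : M →ₘ[m] ℝ) ≠ ⊤ :=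
    ENNReal.add_ne_top.mpr ⟨ENNReal.mul_ne_top ENNReal.coe_ne_top hρU,
      ENNReal.mul_ne_top ENNReal.coe_ne_top hσU⟩
  have hs : m {x | ρ x ≠ σ x} ≠ 0 := by
    intro h0
    exact hne (Lp.ext (ae_iff.mpr h0))
  rw [← lintegral_orlicz_combo] at hle hfin ⊢
  refine lintegral_strict_mono_of_ae_le_of_ae_lt_on (s := {x | ρ x ≠ σ x})
    ?_ ?_ ?_ hs ?_
  · simp only [ENNReal.coe_add, ENNReal.coe_mul]
    exact ((aemeasurable_orlicz_comp ρ).const_mul _).add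
      ((aemeasurable_orlicz_comp σ).const_mul _)
  · exact ne_top_of_le_ne_top hfin hle
  · filter_upwards [nnnorm_combo_ae hρ hσ a b] with x hx
    rw [hx]
    exact_mod_cast U.map_combo_le hab _ _
  · filter_upwards [nnnorm_combo_ae hρ hσ a b, hρ, hσ] with x hx h1 h2 hxne
    rw [hx]
    have hne' : ‖ρ x‖₊ ≠ ‖σ x‖₊ := by
      intro h
      have := congrArg NNReal.toReal h
      rw [coe_nnnorm, coe_nnnorm, Real.norm_of_nonneg h1, Real.norm_of_nonneg h2] at this
      exact hxne this
    have := hstrict.2 (mem_univ _) (mem_univ _) hne' ha hb hab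
    exact_mod_cast this

theorem lowerSemicontinuousOn_internalEnergy (hU : ∀ x : ℝ≥0, (U x : ℝ) = x * Θ x)
    (hcont : Continuous U) :
    LowerSemicontinuousOn (internalEnergy Θ m) {ρ | IsProbDensity m ρ} := by
  refine lowerSemicontinuousOn_of_seq fun u ρ c hu hρ hlim hc => ?_
  obtain ⟨ns, -, hns⟩ := (tendstoInMeasure_of_tendsto_Lp hlim).exists_seq_tendsto_ae
  rw [internalEnergy_eq_modular hU hρ.1]
  have hc' : ∀ n, U.modular m (u (ns n) : M →ₘ[m] ℝ) ≤ c := fun n =>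
    (internalEnergy_eq_modular hU (hu (ns n)).1).symm.trans_le (hc _)
  calc U.modular m (ρ : M →ₘ[m] ℝ)
      = ∫⁻ x, liminf (fun n => (U ‖u (ns n) x‖₊ : ℝ≥0∞)) atTop ∂m := by
        refine lintegral_congr_ae ?_
        filter_upwards [hns] with x hx
        refine (Tendsto.liminf_eq ?_).symm
        exact (ENNReal.continuous_coe.comp (hcont.comp continuous_nnnorm)).continuousAt.tendsto.comp
          hx
    _ ≤ liminf (fun n => ∫⁻ x, (U ‖u (ns n) x‖₊ : ℝ≥0∞) ∂m) atTop :=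
        lintegral_liminf_le' fun n => aemeasurable_orlicz_comp _
    _ ≤ c := by
        refine liminf_le_of_le (by isBoundedDefault) fun b hb => ?_
        obtain ⟨n, hn⟩ := hb.exists
        exact hn.trans (hc' n)

end InternalEnergy

/-! ### Weak compactness in `L¹` from a modular bound -/

section WeakCompactnessOfSublevels

variable {M : Type*} [MeasurableSpace M] {m : Measure M} {U : OrliczFunction}

/-- De la Vallée Poussin bound: where `U(x) ≥ B x` beyond `R`, truncating at height `R` changes a
function by at most `B⁻¹ ∫ U(|ρ|)` in `L¹`. -/
theorem lintegral_sub_min_le {B R : ℝ≥0} (hB : 0 < B) (hR : ∀ x, R ≤ x → B * x ≤ U x)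
    (ρ : Lp ℝ 1 m) :
    ∫⁻ x, ‖min (ρ x) R - ρ x‖ₑ ∂m ≤ (B : ℝ≥0∞)⁻¹ * U.modular m (ρ : M →ₘ[m] ℝ) := by
  rw [OrliczFunction.modular, ← lintegral_const_mul' _ _ (by simpa using hB.ne')]
  refine lintegral_mono fun x => ?_
  rcases le_total (ρ x) R with h | h
  · simp [min_eq_left h]
  · have h0 : 0 ≤ ρ x := R.2.trans h
    have h1 : R ≤ ‖ρ x‖₊ := by
      rw [← NNReal.coe_le_coe, coe_nnnorm, Real.norm_of_nonneg h0]; exact h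
    have h2 : ‖min (ρ x) R - ρ x‖₊ ≤ ‖ρ x‖₊ := by
      rw [← NNReal.coe_le_coe, coe_nnnorm, coe_nnnorm, min_eq_right h, Real.norm_of_nonneg h0,
        Real.norm_of_nonpos (by linarith)]
      have := R.2
      linarith
    calc ‖min (ρ x) R - ρ x‖ₑ ≤ ‖ρ x‖ₑ := ENNReal.coe_le_coe.mpr h2
      _ = (B : ℝ≥0∞)⁻¹ * (B * ‖ρ x‖₊) := by
        rw [← mul_assoc, ENNReal.inv_mul_cancel (by simpa using hB.ne') ENNReal.coe_ne_top, one_mul]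
        rfl
      _ ≤ _ := by gcongr; exact_mod_cast hR _ h1

variable [IsFiniteMeasure m]

theorem memLp_min_const (ρ : Lp ℝ 1 m) (hρ : ∀ᵐ x ∂m, 0 ≤ ρ x) (R : ℝ≥0) (p : ℝ≥0∞) :
    MemLp (fun x => min (ρ x) (R : ℝ)) p m := by
  refine MemLp.of_bound ((Lp.aestronglyMeasurable ρ).inf aestronglyMeasurable_const) R ?_
  filter_upwards [hρ] with x hx
  rw [Real.norm_of_nonneg (le_min hx R.coe_nonneg)]
  exact min_le_right _ _

/-- A weakly closed set of nonnegative functions of bounded modular, for a superlinear `U`, is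
weakly compact in `L¹`: truncation at height `R` maps it into a ball of `L²`. -/
theorem isCompact_weak_of_modular_le
    (hgrow : ∀ B : ℝ≥0, ∃ R : ℝ≥0, ∀ x, R ≤ x → B * x ≤ U x)
    {A : Set (Lp ℝ 1 m)} {K : ℝ≥0} (hA : ∀ ρ ∈ A, (∀ᵐ x ∂m, 0 ≤ ρ x) ∧
      U.modular m (ρ : M →ₘ[m] ℝ) ≤ K) (hcl : IsClosed (toWeakSpace ℝ (Lp ℝ 1 m) '' A)) :
    IsCompact (toWeakSpace ℝ (Lp ℝ 1 m) '' A) := by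
  classical
  choose R hR using fun n : ℕ => hgrow ((n : ℝ≥0) + 1)
  have h12 : (1 : ℝ≥0∞) ≤ 2 := by norm_num
  -- The continuous inclusion of `L²` into `L¹` over a finite measure.
  let J : Lp ℝ 2 m →L[ℝ] Lp ℝ 1 m := LinearMap.mkContinuous
    { toFun := fun h => (((Lp.memLp h).mono_exponent h12).toLp h : Lp ℝ 1 m)
      map_add' := fun h k => by
        rw [← MemLp.toLp_add]
        exact MemLp.toLp_congr _ _ (Lp.coeFn_add h k)
      map_smul' := fun c h => by
        rw [RingHom.id_apply, ← MemLp.toLp_const_smul]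
        exact MemLp.toLp_congr _ _ (Lp.coeFn_smul c h) }
    ((m univ ^ (1 / (1 : ℝ≥0∞).toReal - 1 / (2 : ℝ≥0∞).toReal)).toReal) (by
      intro h
      change ‖(((Lp.memLp h).mono_exponent h12).toLp h : Lp ℝ 1 m)‖ ≤ _
      rw [Lp.norm_toLp, Lp.norm_def, ← ENNReal.toReal_mul, mul_comm]
      refine ENNReal.toReal_mono (ENNReal.mul_ne_top (Lp.eLpNorm_ne_top h) ?_)
        (eLpNorm_le_eLpNorm_mul_rpow_measure_univ h12 (Lp.aestronglyMeasurable h))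
      exact ENNReal.rpow_ne_top_of_nonneg (by norm_num) (measure_ne_top m univ))
  have hJ : ∀ h : Lp ℝ 2 m, J h = ((Lp.memLp h).mono_exponent h12).toLp h := fun h => rfl
  -- Truncation at the height beyond which `U(x) ≥ (n + 1) x`; only its values on nonnegative
  -- functions matter.
  let T : ℕ → Lp ℝ 1 m → Lp ℝ 1 m := fun n ρ =>
    if h : ∀ᵐ x ∂m, 0 ≤ ρ x then (memLp_min_const ρ h (R n) 1).toLp _ else 0
  let r : ℕ → ℝ := fun n => (m univ ^ (1 / (2 : ℝ≥0∞).toReal)).toReal * R n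
  refine isCompact_weak_of_approx T (fun n => J '' Metric.closedBall 0 (r n))
    (fun n => K / ((n : ℝ) + 1)) ?_ (fun n => isCompact_weak_image_closedBall J (r n)) ?_ ?_ hcl
  · exact tendsto_const_div_atTop_nhds_zero_nat (K : ℝ) |>.comp (tendsto_add_atTop_nat 1) |>.congr
      fun n => by simp
  · intro n ρ hρ
    have h0 := (hA ρ hρ).1
    refine ⟨(memLp_min_const ρ h0 (R n) 2).toLp _, ?_, ?_⟩
    · rw [mem_closedBall_zero_iff, Lp.norm_toLp]
      refine (ENNReal.toReal_mono (ENNReal.mul_ne_top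
        (ENNReal.rpow_ne_top_of_nonneg (by positivity) (measure_ne_top m univ))
        ENNReal.ofReal_ne_top)
        (eLpNorm_le_of_ae_bound (C := (R n : ℝ)) ?_)).trans ?_
      · filter_upwards [h0] with x hx
        rw [Real.norm_of_nonneg (le_min hx (R n).coe_nonneg)]
        exact min_le_right _ _
      · rw [ENNReal.toReal_mul, ENNReal.toReal_ofReal (R n).coe_nonneg]
        simp [r]
    · rw [hJ]
      simp only [T, dif_pos h0]
      exact MemLp.toLp_congr _ _ (MemLp.coeFn_toLp _)
  · intro n ρ hρ
    obtain ⟨h0, hK⟩ := hA ρ hρ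
    simp only [T, dif_pos h0]
    rw [Lp.norm_def, eLpNorm_one_eq_lintegral_enorm]
    have h1 : ∫⁻ x, ‖((memLp_min_const ρ h0 (R n) 1).toLp _ - ρ : Lp ℝ 1 m) x‖ₑ ∂m =
        ∫⁻ x, ‖min (ρ x) (R n) - ρ x‖ₑ ∂m := by
      refine lintegral_congr_ae ?_
      filter_upwards [Lp.coeFn_sub ((memLp_min_const ρ h0 (R n) 1).toLp _) ρ,
        MemLp.coeFn_toLp (memLp_min_const ρ h0 (R n) 1)] with x hx1 hx2
      rw [hx1, Pi.sub_apply, hx2]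
    rw [h1]
    have h2 := (lintegral_sub_min_le (by positivity) (hR n) ρ).trans (mul_le_mul_right hK _)
    refine (ENNReal.toReal_mono ?_ h2).trans (le_of_eq ?_)
    · exact ENNReal.mul_ne_top (by simp) ENNReal.coe_ne_top
    · rw [ENNReal.toReal_mul, ENNReal.toReal_inv, ENNReal.coe_toReal, ENNReal.coe_toReal,
        div_eq_inv_mul]
      push_cast
      rfl

end WeakCompactnessOfSublevels

/-! ### Sublevel sets and minimisers of the energy -/

section EnergySublevels

variable {M : Type*} [MetricSpace M] [MeasurableSpace M] {m : Measure M} {Θ : ℝ → ℝ}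
  {U : OrliczFunction} {f : Lp ℝ 1 m}

theorem totalEnergy_combo_le (hU : ∀ x : ℝ≥0, (U x : ℝ) = x * Θ x) (hf : IsProbDensity m f)
    {ρ σ : Lp ℝ 1 m} (hρ : IsProbDensity m ρ) (hσ : IsProbDensity m σ) {a b : ℝ≥0}
    (hab : a + b = 1) :
    totalEnergy Θ m f ((a : ℝ) • ρ + (b : ℝ) • σ) ≤
      a * totalEnergy Θ m f ρ + b * totalEnergy Θ m f σ := by
  have : IsProbabilityMeasure (densityMeasure m f) := isProbabilityMeasure_densityMeasure hf
  rcases eq_or_ne a 0 with rfl | ha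
  · obtain rfl : b = 1 := by simpa using hab
    simp
  rcases eq_or_ne b 0 with rfl | hb
  · obtain rfl : a = 1 := by simpa using hab
    simp
  have hc : IsProbDensity m ((a : ℝ) • ρ + (b : ℝ) • σ) :=
    hρ.combo hσ a.coe_nonneg b.coe_nonneg (by exact_mod_cast hab)
  have h1 := modular_combo_le (U := U) hρ.1 hσ.1 hab
  rw [← internalEnergy_eq_modular hU hc.1, ← internalEnergy_eq_modular hU hρ.1,
    ← internalEnergy_eq_modular hU hσ.1] at h1
  have h2 := wassersteinSq_combo_le (densityMeasure m ρ) (densityMeasure m σ) (densityMeasure m f)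
    (a := a) (b := b) (by simpa using ha) (by simpa using hb) (by exact_mod_cast hab)
  have h3 := densityMeasure_combo hρ hσ a.coe_nonneg b.coe_nonneg
  rw [ENNReal.ofReal_coe_nnreal, ENNReal.ofReal_coe_nnreal] at h3
  rw [← h3] at h2
  refine (add_le_add h2 h1).trans (le_of_eq ?_)
  rw [totalEnergy, totalEnergy]
  ring

theorem convex_sublevel_totalEnergy (hU : ∀ x : ℝ≥0, (U x : ℝ) = x * Θ x)
    (hf : IsProbDensity m f) (c : ℝ≥0∞) :
    Convex ℝ {ρ : Lp ℝ 1 m | IsProbDensity m ρ ∧ totalEnergy Θ m f ρ ≤ c} := by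
  rintro ρ ⟨hρ, hρc⟩ σ ⟨hσ, hσc⟩ a b ha hb hab
  refine ⟨hρ.combo hσ ha hb hab, ?_⟩
  lift a to ℝ≥0 using ha
  lift b to ℝ≥0 using hb
  have hab' : a + b = 1 := by exact_mod_cast hab
  calc totalEnergy Θ m f ((a : ℝ) • ρ + (b : ℝ) • σ)
      ≤ a * totalEnergy Θ m f ρ + b * totalEnergy Θ m f σ := totalEnergy_combo_le hU hf hρ hσ hab'
    _ ≤ a * c + b * c := by gcongr
    _ = ((a + b : ℝ≥0) : ℝ≥0∞) * c := by push_cast; ring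
    _ = c := by rw [hab', ENNReal.coe_one, one_mul]

theorem modular_le_of_mem_energySublevel (hU : ∀ x : ℝ≥0, (U x : ℝ) = x * Θ x) {K : ℝ}
    {ρ : Lp ℝ 1 m} (hρ : ρ ∈ energySublevel Θ m f K) :
    U.modular m (ρ : M →ₘ[m] ℝ) ≤ K.toNNReal := by
  rw [← internalEnergy_eq_modular hU hρ.1.1]
  exact le_add_self.trans hρ.2

/-- Strict convexity of the internal energy and convexity of the transport cost make the energy of
the midpoint of two distinct minimisers strictly smaller. -/
theorem minimizer_totalEnergy_unique (hU : ∀ x : ℝ≥0, (U x : ℝ) = x * Θ x)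
    (hstrict : StrictConvexOn ℝ≥0 univ U) (hf : IsProbDensity m f) {K : ℝ} {ρ σ : Lp ℝ 1 m}
    (hρ : ρ ∈ energySublevel Θ m f K) (hσ : σ ∈ energySublevel Θ m f K)
    (hρmin : ∀ τ ∈ energySublevel Θ m f K, totalEnergy Θ m f ρ ≤ totalEnergy Θ m f τ)
    (hσmin : ∀ τ ∈ energySublevel Θ m f K, totalEnergy Θ m f σ ≤ totalEnergy Θ m f τ) :
    ρ = σ := by
  by_contra hne
  have : IsProbabilityMeasure (densityMeasure m f) := isProbabilityMeasure_densityMeasure hf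
  have heq : totalEnergy Θ m f ρ = totalEnergy Θ m f σ := le_antisymm (hρmin σ hσ) (hσmin ρ hρ)
  set a : ℝ≥0 := 2⁻¹ with ha
  have ha0 : 0 < a := by simp [ha]
  have haa : a + a = 1 := by rw [ha, ← two_mul]; simp
  have hmid : (a : ℝ) • ρ + (a : ℝ) • σ ∈ energySublevel Θ m f K :=
    convex_sublevel_totalEnergy hU hf (ENNReal.ofReal K) hρ hσ a.coe_nonneg a.coe_nonneg
      (by exact_mod_cast haa)
  have hfin : ∀ τ ∈ energySublevel Θ m f K, U.modular m (τ : M →ₘ[m] ℝ) ≠ ⊤ := fun τ hτ =>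
    ne_top_of_le_ne_top ENNReal.coe_ne_top (modular_le_of_mem_energySublevel hU hτ)
  have h1 := modular_combo_lt hstrict hρ.1.1 hσ.1.1 hne (hfin ρ hρ) (hfin σ hσ) ha0 ha0 haa
  rw [← internalEnergy_eq_modular hU hmid.1.1, ← internalEnergy_eq_modular hU hρ.1.1,
    ← internalEnergy_eq_modular hU hσ.1.1] at h1
  have h2 := wassersteinSq_combo_le (densityMeasure m ρ) (densityMeasure m σ) (densityMeasure m f)
    (a := a) (b := a) (by simpa using ha0.ne') (by simpa using ha0.ne') (by exact_mod_cast haa)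
  have h3 := densityMeasure_combo hρ.1 hσ.1 a.coe_nonneg a.coe_nonneg
  rw [ENNReal.ofReal_coe_nnreal] at h3
  rw [← h3] at h2
  have hW : wassersteinSq (densityMeasure m ((a : ℝ) • ρ + (a : ℝ) • σ)) (densityMeasure m f) ≠ ⊤ :=
    ne_top_of_le_ne_top ENNReal.ofReal_ne_top (le_self_add.trans hmid.2)
  have h4 : totalEnergy Θ m f ((a : ℝ) • ρ + (a : ℝ) • σ) < totalEnergy Θ m f ρ :=
    calc totalEnergy Θ m f ((a : ℝ) • ρ + (a : ℝ) • σ) <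
        _ + _ := ENNReal.add_lt_add_of_le_of_lt hW h2 h1
      _ = a * totalEnergy Θ m f ρ + a * totalEnergy Θ m f σ := by
        rw [totalEnergy, totalEnergy]; ring
      _ = ((a + a : ℝ≥0) : ℝ≥0∞) * totalEnergy Θ m f ρ := by rw [← heq]; push_cast; ring
      _ = _ := by rw [haa, ENNReal.coe_one, one_mul]
  exact absurd (hρmin _ hmid) (not_le.mpr h4)

variable [CompactSpace M] [BorelSpace M]

theorem mem_energySublevel_self (hf : IsProbDensity m f) {K : ℝ}
    (hK : internalEnergy Θ m f < ENNReal.ofReal K) : f ∈ energySublevel Θ m f K := by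
  have : IsProbabilityMeasure (densityMeasure m f) := isProbabilityMeasure_densityMeasure hf
  refine ⟨hf, ?_⟩
  rw [totalEnergy, wassersteinSq_self, zero_add]
  exact hK.le

variable [IsFiniteMeasure m]

theorem isClosed_sublevel_totalEnergy (hU : ∀ x : ℝ≥0, (U x : ℝ) = x * Θ x) (hcont : Continuous U)
    (hf : IsProbDensity m f) (c : ℝ≥0∞) :
    IsClosed {ρ : Lp ℝ 1 m | IsProbDensity m ρ ∧ totalEnergy Θ m f ρ ≤ c} := by
  have : IsProbabilityMeasure (densityMeasure m f) := isProbabilityMeasure_densityMeasure hf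
  have hlsc : LowerSemicontinuousOn (totalEnergy Θ m f) {ρ | IsProbDensity m ρ} :=
    lowerSemicontinuousOn_wassersteinSq.add (lowerSemicontinuousOn_internalEnergy hU hcont)
  obtain ⟨v, hv, hv2⟩ := lowerSemicontinuousOn_iff_preimage_Iic.mp hlsc c
  have h := isClosed_setOf_isProbDensity.inter hv
  rw [← hv2] at h
  exact h

theorem isClosed_weak_sublevel_totalEnergy (hU : ∀ x : ℝ≥0, (U x : ℝ) = x * Θ x)
    (hcont : Continuous U) (hf : IsProbDensity m f) (c : ℝ≥0∞) :
    IsClosed (toWeakSpace ℝ (Lp ℝ 1 m) ''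
      {ρ : Lp ℝ 1 m | IsProbDensity m ρ ∧ totalEnergy Θ m f ρ ≤ c}) := by
  have h := (convex_sublevel_totalEnergy hU hf c).toWeakSpace_closure ℝ
  rw [(isClosed_sublevel_totalEnergy hU hcont hf c).closure_eq] at h
  rw [h]
  exact isClosed_closure

theorem isCompact_weak_energySublevel (hU : ∀ x : ℝ≥0, (U x : ℝ) = x * Θ x)
    (hcont : Continuous U) (hgrow : ∀ B : ℝ≥0, ∃ R : ℝ≥0, ∀ x, R ≤ x → B * x ≤ U x)
    (hf : IsProbDensity m f) (K : ℝ) :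
    IsCompact (toWeakSpace ℝ (Lp ℝ 1 m) '' energySublevel Θ m f K) :=
  isCompact_weak_of_modular_le hgrow
    (fun _ hρ => ⟨hρ.1.1, modular_le_of_mem_energySublevel hU hρ⟩)
    (isClosed_weak_sublevel_totalEnergy hU hcont hf _)

theorem isSeqCompact_weak_energySublevel (hU : ∀ x : ℝ≥0, (U x : ℝ) = x * Θ x)
    (hcont : Continuous U) (hgrow : ∀ B : ℝ≥0, ∃ R : ℝ≥0, ∀ x, R ≤ x → B * x ≤ U x)
    (hf : IsProbDensity m f) (K : ℝ) :
    IsSeqCompact (toWeakSpace ℝ (Lp ℝ 1 m) '' energySublevel Θ m f K) := by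
  have : Fact ((1 : ℝ≥0∞) ≠ ⊤) := ⟨ENNReal.one_ne_top⟩
  exact isSeqCompact_weak_of_isCompact (isCompact_weak_energySublevel hU hcont hgrow hf K)

theorem exists_minimizer_totalEnergy (hU : ∀ x : ℝ≥0, (U x : ℝ) = x * Θ x)
    (hcont : Continuous U) (hgrow : ∀ B : ℝ≥0, ∃ R : ℝ≥0, ∀ x, R ≤ x → B * x ≤ U x)
    (hf : IsProbDensity m f) {K : ℝ} (hK : internalEnergy Θ m f < ENNReal.ofReal K) :
    ∃ ρ₁ ∈ energySublevel Θ m f K,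
      ∀ ρ ∈ energySublevel Θ m f K, totalEnergy Θ m f ρ₁ ≤ totalEnergy Θ m f ρ := by
  -- The energy is weakly lower semicontinuous: its sublevel sets are weakly closed.
  have hlsc : LowerSemicontinuousOn
      (fun w => totalEnergy Θ m f ((toWeakSpace ℝ (Lp ℝ 1 m)).symm w))
      (toWeakSpace ℝ (Lp ℝ 1 m) '' energySublevel Θ m f K) := by
    refine lowerSemicontinuousOn_iff_preimage_Iic.mpr fun c =>
      ⟨_, isClosed_weak_sublevel_totalEnergy hU hcont hf c, ?_⟩
    ext w
    refine and_congr_right ?_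
    rintro ⟨ρ, hρ, rfl⟩
    rw [(toWeakSpace ℝ (Lp ℝ 1 m)).injective.mem_set_image]
    simp [hρ.1]
  obtain ⟨_, ⟨ρ₁, hρ₁, rfl⟩, hmin⟩ := hlsc.exists_isMinOn
    ⟨_, mem_image_of_mem _ (mem_energySublevel_self hf hK)⟩
    (isCompact_weak_energySublevel hU hcont hgrow hf K)
  exact ⟨ρ₁, hρ₁, fun ρ hρ => by simpa using hmin (mem_image_of_mem _ hρ)⟩

end EnergySublevels

/-! ### The bound of the internal energy by superlevel sets -/

section LayerCake

variable {M : Type*} [MeasurableSpace M] {m : Measure M} {Θ : ℝ → ℝ}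

/-- Since `Θ` is increasing, `x Θ(x)` is at most twice the integral of `Θ(2 l)` over
`x / 2 < l < x`. -/
theorem ofReal_mul_theta_le (hmono : StrictMono fun r : ℝ => Θ (Real.exp r)) {x : ℝ} (hx : 0 ≤ x) :
    ENNReal.ofReal (x * Θ x) ≤
      2 * ∫⁻ l in Ioi (0 : ℝ), (Iio x).indicator (fun l => ENNReal.ofReal (Θ (2 * l))) l := by
  rcases hx.eq_or_lt with rfl | hx
  · simp
  calc ENNReal.ofReal (x * Θ x)
      = 2 * ∫⁻ _ in Ioo (x / 2) x, ENNReal.ofReal (Θ x) := by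
        rw [setLIntegral_const, Real.volume_Ioo, sub_half, ← ENNReal.ofReal_ofNat 2,
          mul_comm (ENNReal.ofReal (Θ x)), ← mul_assoc, ← ENNReal.ofReal_mul two_pos.le,
          mul_div_cancel₀ _ (two_ne_zero' ℝ), ← ENNReal.ofReal_mul hx.le]
    _ ≤ 2 * ∫⁻ l in Ioo (x / 2) x, (Iio x).indicator (fun l => ENNReal.ofReal (Θ (2 * l))) l := by
        gcongr 2 * ?_
        refine setLIntegral_mono' measurableSet_Ioo fun l hl => ?_
        rw [indicator_of_mem (mem_Iio.mpr hl.2)]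
        exact ENNReal.ofReal_le_ofReal (theta_le_theta hmono hx (by linarith [hl.1]))
    _ ≤ _ := by
        gcongr 2 * ?_
        exact lintegral_mono_set fun l hl => mem_Ioi.mpr ((half_pos hx).trans hl.1)

theorem mul_measure_superlevel_le_one {ρ : Lp ℝ 1 m} (hρ : IsProbDensity m ρ) (l : ℝ) :
    ENNReal.ofReal l * m {x | l < ρ x} ≤ 1 := by
  calc ENNReal.ofReal l * m {x | l < ρ x}
      ≤ ENNReal.ofReal l * m {x | ENNReal.ofReal l ≤ ENNReal.ofReal (ρ x)} := by
        gcongr _ * ?_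
        exact measure_mono fun x hx => ENNReal.ofReal_le_ofReal (le_of_lt hx)
    _ ≤ ∫⁻ x, ENNReal.ofReal (ρ x) ∂m := mul_meas_ge_le_lintegral₀ (aemeasurable_ofReal_coe ρ) _
    _ = 1 := by
        rw [← ofReal_integral_eq_lintegral_ofReal (integrable_coe ρ) hρ.1, hρ.2,
          ENNReal.ofReal_one]

variable [IsFiniteMeasure m]

/-- The layer cake formula applied to the bound `ofReal_mul_theta_le`, combined with Chebyshev's
inequality `l ≤ 1 / m {ρ > l}`. -/
theorem internalEnergy_le_lintegral_superlevel (hmono : StrictMono fun r : ℝ => Θ (Real.exp r))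
    {ρ : Lp ℝ 1 m} (hρ : IsProbDensity m ρ) :
    internalEnergy Θ m ρ ≤ 2 * ∫⁻ l in Ioi (0 : ℝ),
      ENNReal.ofReal (Θ (2 / (m {x | l < ρ x}).toReal) * (m {x | l < ρ x}).toReal) := by
  have hρm : Measurable ρ := (Lp.stronglyMeasurable ρ).measurable
  have hΘ2 : AEMeasurable (fun l => ENNReal.ofReal (Θ (2 * l))) (volume.restrict (Ioi (0 : ℝ))) := by
    refine AEMeasurable.ennreal_ofReal (aemeasurable_restrict_of_monotoneOn measurableSet_Ioi ?_)
    intro a ha b _ hab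
    exact theta_le_theta hmono (by have := mem_Ioi.mp ha; positivity) (by linarith)
  have hset : MeasurableSet {p : M × ℝ | p.2 < ρ p.1} :=
    measurableSet_lt measurable_snd (hρm.comp measurable_fst)
  have hmeas : AEMeasurable (Function.uncurry fun (x : M) (l : ℝ) =>
      (Iio (ρ x)).indicator (fun l => ENNReal.ofReal (Θ (2 * l))) l)
      (m.prod (volume.restrict (Ioi (0 : ℝ)))) :=
    (hΘ2.comp_snd (μ := m)).indicator hset
  calc internalEnergy Θ m ρ
      ≤ ∫⁻ x, (2 * ∫⁻ l in Ioi (0 : ℝ),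
          (Iio (ρ x)).indicator (fun l => ENNReal.ofReal (Θ (2 * l))) l) ∂m := by
        refine lintegral_mono_ae ?_
        filter_upwards [hρ.1] with x hx
        exact ofReal_mul_theta_le hmono hx
    _ = 2 * ∫⁻ l in Ioi (0 : ℝ), ∫⁻ x,
          (Iio (ρ x)).indicator (fun l => ENNReal.ofReal (Θ (2 * l))) l ∂m := by
        rw [lintegral_const_mul' _ _ ENNReal.ofNat_ne_top, lintegral_lintegral_swap hmeas]
    _ ≤ _ := by
        gcongr 2 * ?_
        refine setLIntegral_mono' measurableSet_Ioi fun l hl => ?_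
        have h1 : ∫⁻ x, (Iio (ρ x)).indicator (fun l => ENNReal.ofReal (Θ (2 * l))) l ∂m =
            ENNReal.ofReal (Θ (2 * l)) * m {x | l < ρ x} := by
          rw [← lintegral_indicator_const (measurableSet_lt measurable_const hρm)]
          rfl
        rw [h1]
        have hfin : m {x | l < ρ x} ≠ ⊤ := measure_ne_top _ _
        rcases eq_or_ne (m {x | l < ρ x}) 0 with h0 | h0
        · simp [h0]
        have hpos : 0 < (m {x | l < ρ x}).toReal := ENNReal.toReal_pos h0 hfin
        rw [ENNReal.ofReal_mul' hpos.le, ENNReal.ofReal_toReal hfin]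
        gcongr
        refine theta_le_theta hmono (by have := mem_Ioi.mp hl; positivity) ?_
        rw [le_div_iff₀ hpos]
        have h2 := ENNReal.toReal_mono ENNReal.one_ne_top (mul_measure_superlevel_le_one hρ l)
        rw [ENNReal.toReal_mul, ENNReal.toReal_ofReal (mem_Ioi.mp hl).le, ENNReal.toReal_one] at h2
        linarith

end LayerCake

/-! ### The Legendre transform of an Orlicz function -/

section Legendre

variable {F : ℝ → ℝ} {U : OrliczFunction}

theorem bddAbove_range_legendre (hF : ∀ x : ℝ≥0, (U x : ℝ) = F x)
    (hgrow : ∀ B : ℝ≥0, ∃ R : ℝ≥0, ∀ x, R ≤ x → B * x ≤ U x) (v : ℝ) :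
    BddAbove (range fun u : Ioi (0 : ℝ) => (u : ℝ) * v - F u) := by
  obtain ⟨R, hR⟩ := hgrow ‖v‖₊
  refine ⟨R * |v|, ?_⟩
  rintro _ ⟨⟨u, hu⟩, rfl⟩
  lift u to ℝ≥0 using (mem_Ioi.mp hu).le
  have h1 : (u : ℝ) * v ≤ u * |v| := mul_le_mul_of_nonneg_left (le_abs_self v) u.coe_nonneg
  have h2 : 0 ≤ (R : ℝ) * |v| := by positivity
  change (u : ℝ) * v - F u ≤ R * |v|
  rw [← hF]
  rcases le_total R u with h | h
  · have h3 : |v| * (u : ℝ) ≤ U u := by exact_mod_cast hR u h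
    linarith
  · have h3 : (u : ℝ) * |v| ≤ R * |v| := by gcongr
    have := (U u).coe_nonneg
    linarith

theorem mul_le_add_legendre_of_pos (hF : ∀ x : ℝ≥0, (U x : ℝ) = F x)
    (hgrow : ∀ B : ℝ≥0, ∃ R : ℝ≥0, ∀ x, R ≤ x → B * x ≤ U x)
    {u : ℝ≥0} (hu : 0 < u) (v : ℝ) :
    (u : ℝ) * v ≤ U u + legendreTransform F v := by
  have := le_ciSup (bddAbove_range_legendre hF hgrow v) ⟨(u : ℝ), mem_Ioi.mpr hu⟩
  rw [hF, legendreTransform]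
  change (u : ℝ) * v - F u ≤ _ at this
  linarith

theorem mul_le_add_legendre (hF : ∀ x : ℝ≥0, (U x : ℝ) = F x) (hcont : Continuous U)
    (hgrow : ∀ B : ℝ≥0, ∃ R : ℝ≥0, ∀ x, R ≤ x → B * x ≤ U x)
    (u : ℝ≥0) (v : ℝ) : (u : ℝ) * v ≤ U u + legendreTransform F v := by
  have hcl : IsClosed {u : ℝ≥0 | (u : ℝ) * v ≤ U u + legendreTransform F v} :=
    isClosed_le (by fun_prop) (by fun_prop)
  have hsub : closure (Ioi (0 : ℝ≥0)) ⊆ {u : ℝ≥0 | (u : ℝ) * v ≤ U u + legendreTransform F v} :=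
    hcl.closure_subset_iff.mpr fun u hu => mul_le_add_legendre_of_pos hF hgrow hu v
  rw [closure_Ioi] at hsub
  exact hsub (mem_Ici.mpr zero_le)

theorem legendre_nonneg (hF : ∀ x : ℝ≥0, (U x : ℝ) = F x) (hcont : Continuous U)
    (hgrow : ∀ B : ℝ≥0, ∃ R : ℝ≥0, ∀ x, R ≤ x → B * x ≤ U x)
    (v : ℝ) : 0 ≤ legendreTransform F v := by
  simpa [U.map_zero] using mul_le_add_legendre hF hcont hgrow 0 v

theorem convexOn_legendre (hF : ∀ x : ℝ≥0, (U x : ℝ) = F x)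
    (hgrow : ∀ B : ℝ≥0, ∃ R : ℝ≥0, ∀ x, R ≤ x → B * x ≤ U x) :
    ConvexOn ℝ univ (legendreTransform F) := by
  refine ⟨convex_univ, fun v _ w _ a b ha hb hab => ?_⟩
  have : Nonempty (Ioi (0 : ℝ)) := ⟨⟨1, mem_Ioi.mpr one_pos⟩⟩
  refine ciSup_le ?_
  rintro ⟨u, hu⟩
  lift u to ℝ≥0 using (mem_Ioi.mp hu).le
  have hu' : 0 < u := hu
  have h1 := mul_le_add_legendre_of_pos hF hgrow hu' v
  have h2 := mul_le_add_legendre_of_pos hF hgrow hu' w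
  simp only [smul_eq_mul, ← hF]
  calc (u : ℝ) * (a * v + b * w) - U u
      = a * (u * v - U u) + b * (u * w - U u) := by linear_combination (-(U u : ℝ)) * (-hab)
    _ ≤ _ := by gcongr <;> linarith

theorem continuous_legendre (hF : ∀ x : ℝ≥0, (U x : ℝ) = F x)
    (hgrow : ∀ B : ℝ≥0, ∃ R : ℝ≥0, ∀ x, R ≤ x → B * x ≤ U x) :
    Continuous (legendreTransform F) :=
  continuousOn_univ.mp ((convexOn_legendre hF hgrow).continuousOn isOpen_univ)

/-- A point attaining the supremum up to the error `1`. Over a finite measure such a constant error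
is integrable, so attainment is not needed. -/
theorem exists_legendre_sub_one_le (hF : ∀ x : ℝ≥0, (U x : ℝ) = F x) (v : ℝ) :
    ∃ u : ℝ≥0, legendreTransform F v + U u ≤ u * v + 1 := by
  have : Nonempty (Ioi (0 : ℝ)) := ⟨⟨1, mem_Ioi.mpr one_pos⟩⟩
  obtain ⟨⟨u, hu⟩, h⟩ := exists_lt_of_lt_ciSup
    (show legendreTransform F v - 1 < ⨆ u : Ioi (0 : ℝ), ((u : ℝ) * v - F u) from sub_one_lt _)
  lift u to ℝ≥0 using (mem_Ioi.mp hu).le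
  refine ⟨u, ?_⟩
  rw [hF]
  change _ < (u : ℝ) * v - F u at h
  linarith

end Legendre

/-! ### Densities of set functions -/

section RadonNikodym

variable {α : Type*} [MeasurableSpace α] {m : Measure α} [IsFiniteMeasure m]

/-- **Radon–Nikodym** for a finitely additive set function which is small on sets of small
measure: such a set function is countably additive, hence has an integrable density. -/
theorem exists_integrable_setIntegral_eq {ν : Set α → ℝ}
    (hadd : ∀ A B, MeasurableSet A → MeasurableSet B → Disjoint A B → ν (A ∪ B) = ν A + ν B)
    (hsmall : ∀ ε : ℝ, 0 < ε → ∃ δ : ℝ, 0 < δ ∧ ∀ A, MeasurableSet A → m.real A < δ → |ν A| < ε) :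
    ∃ g : α → ℝ, Measurable g ∧ Integrable g m ∧
      ∀ A, MeasurableSet A → ν A = ∫ x in A, g x ∂m := by
  classical
  have hzero : ∀ A, MeasurableSet A → m.real A = 0 → ν A = 0 := by
    intro A hA h0
    by_contra hne
    obtain ⟨δ, hδ, h⟩ := hsmall _ (abs_pos.mpr hne)
    exact lt_irrefl _ (h A hA (h0 ▸ hδ))
  have hempty : ν ∅ = 0 := hzero ∅ MeasurableSet.empty (by simp)
  have hfin : ∀ (A : ℕ → Set α) (t : Finset ℕ), (∀ i, MeasurableSet (A i)) →
      Pairwise (Function.onFun Disjoint A) → ν (⋃ i ∈ t, A i) = ∑ i ∈ t, ν (A i) := by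
    intro A t hA hd
    induction t using Finset.induction with
    | empty => simpa using hempty
    | insert a t ha ih =>
      rw [Finset.set_biUnion_insert, Finset.sum_insert ha, ← ih]
      refine hadd _ _ (hA a) (t.measurableSet_biUnion fun i _ => hA i) ?_
      rw [disjoint_iUnion₂_right]
      intro i hi
      exact hd fun h => ha (h ▸ hi)
  let s : SignedMeasure α :=
    { measureOf' := fun A => if MeasurableSet A then ν A else 0
      empty' := by simp [hempty]
      not_measurable' := fun A hA => if_neg hA
      m_iUnion' := by
        intro A hA hd
        have hU : MeasurableSet (⋃ i, A i) := MeasurableSet.iUnion hA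
        simp only [hA, hU, if_true]
        have hm : HasSum (fun i => m.real (A i)) (m.real (⋃ i, A i)) := by
          have := m.toSignedMeasure.m_iUnion hA hd
          simpa [Measure.toSignedMeasure_apply_measurable, hA, hU] using this
        rw [HasSum, SummationFilter.unconditional_filter, Metric.tendsto_nhds]
        intro ε hε
        obtain ⟨δ, hδ, hs⟩ := hsmall ε hε
        rw [HasSum, SummationFilter.unconditional_filter, Metric.tendsto_nhds] at hm
        filter_upwards [hm δ hδ] with t ht
        have ht' : MeasurableSet (⋃ i ∈ t, A i) := t.measurableSet_biUnion fun i _ => hA i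
        have hsub : (⋃ i ∈ t, A i) ⊆ ⋃ i, A i := iUnion₂_subset fun i _ => subset_iUnion A i
        have h1 : m.real (⋃ i, A i) = m.real (⋃ i ∈ t, A i) +
            m.real ((⋃ i, A i) \ ⋃ i ∈ t, A i) := by
          rw [← measureReal_union disjoint_sdiff_right (hU.diff ht') (measure_ne_top _ _)
            (measure_ne_top _ _), union_sdiff_cancel hsub]
        have h2 : ν (⋃ i, A i) = ν (⋃ i ∈ t, A i) + ν ((⋃ i, A i) \ ⋃ i ∈ t, A i) := by
          rw [← hadd _ _ ht' (hU.diff ht') disjoint_sdiff_right, union_sdiff_cancel hsub]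
        have h3 : m.real (⋃ i ∈ t, A i) = ∑ i ∈ t, m.real (A i) :=
          measureReal_biUnion_finset (fun i _ j _ h => hd h) fun i _ => hA i
        rw [dist_comm, Real.dist_eq] at ht ⊢
        rw [h2, hfin A t hA hd, add_sub_cancel_left]
        refine hs _ (hU.diff ht') (lt_of_le_of_lt ?_ ht)
        rw [h1, h3, add_sub_cancel_left]
        exact le_abs_self _ }
  have hs : ∀ A, MeasurableSet A → s A = ν A := fun A hA => if_pos hA
  have hac : s ≪ᵥ m.toENNRealVectorMeasure := by
    refine VectorMeasure.AbsolutelyContinuous.mk fun A hA h0 => ?_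
    rw [Measure.toENNRealVectorMeasure_apply_measurable hA] at h0
    rw [hs A hA]
    exact hzero A hA (by rw [measureReal_def, h0, ENNReal.toReal_zero])
  refine ⟨s.rnDeriv m, SignedMeasure.measurable_rnDeriv s m, SignedMeasure.integrable_rnDeriv s m,
    fun A hA => ?_⟩
  rw [← hs A hA, ← withDensityᵥ_apply (SignedMeasure.integrable_rnDeriv s m) hA,
    SignedMeasure.withDensityᵥ_rnDeriv_eq s m hac]

end RadonNikodym

/-! ### Functionals on the Orlicz space -/

section OrliczDual

variable {α : Type*} [MeasurableSpace α] {m : Measure α} {U : OrliczFunction}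

theorem modular_mk {h : α → ℝ} (hh : AEStronglyMeasurable h m) :
    U.modular m (AEEqFun.mk h hh) = ∫⁻ x, (U ‖h x‖₊ : ℝ≥0∞) ∂m := by
  refine lintegral_congr_ae ?_
  filter_upwards [AEEqFun.coeFn_mk h hh] with x hx
  rw [hx]

theorem modular_smul_eq (c : ℝ) (u : α →ₘ[m] ℝ) :
    U.modular m (c • u) = ∫⁻ x, (U (‖c‖₊ * ‖u x‖₊) : ℝ≥0∞) ∂m := by
  refine lintegral_congr_ae ?_
  filter_upwards [AEEqFun.coeFn_smul c u] with x hx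
  rw [hx, Pi.smul_apply, smul_eq_mul, nnnorm_mul]

/-- A function whose modular is at most `c` admits the scaling `max 1 c`, since
`U(x / l) ≤ U(x) / l` for `l ≥ 1`. -/
theorem max_mem_scalings {u : α →ₘ[m] ℝ} {c : ℝ≥0} (h : U.modular m u ≤ c) :
    ((max 1 c : ℝ≥0) : ℝ) ∈ U.scalings m u := by
  set l : ℝ≥0 := max 1 c with hl
  have hl1 : 1 ≤ l := le_max_left _ _
  have hl0 : 0 < l := one_pos.trans_le hl1
  refine ⟨by exact_mod_cast hl0, ?_⟩
  rw [modular_smul_eq]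
  calc ∫⁻ x, (U (‖(l : ℝ)⁻¹‖₊ * ‖u x‖₊) : ℝ≥0∞) ∂m
      ≤ ∫⁻ x, ((l⁻¹ : ℝ≥0) : ℝ≥0∞) * (U ‖u x‖₊ : ℝ≥0∞) ∂m := by
        refine lintegral_mono fun x => ?_
        have h1 : ‖(l : ℝ)⁻¹‖₊ = l⁻¹ := by simp
        rw [h1]
        rw [← ENNReal.coe_mul]
        exact ENNReal.coe_le_coe.mpr (U.map_mul_le (inv_le_one_of_one_le₀ hl1) _)
    _ = ((l⁻¹ : ℝ≥0) : ℝ≥0∞) * U.modular m u := lintegral_const_mul' _ _ ENNReal.coe_ne_top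
    _ ≤ ((l⁻¹ : ℝ≥0) : ℝ≥0∞) * l := by
        gcongr
        exact h.trans (by exact_mod_cast le_max_right _ _)
    _ = 1 := by rw [← ENNReal.coe_mul, inv_mul_cancel₀ hl0.ne', ENNReal.coe_one]

theorem mem_orliczSpace_of_modular_le {u : α →ₘ[m] ℝ} {c : ℝ≥0} (h : U.modular m u ≤ c) :
    u ∈ U.orliczSpace m :=
  ⟨_, max_mem_scalings h⟩

theorem norm_orlicz_le {u : U.orliczSpace m} {l : ℝ} (hl : l ∈ U.scalings m u.1) : ‖u‖ ≤ l :=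
  csInf_le (U.scalings_bddBelow _) hl

variable [IsFiniteMeasure m]

theorem modular_simpleFunc_lt_top (s : SimpleFunc α ℝ) :
    ∫⁻ x, (U ‖s x‖₊ : ℝ≥0∞) ∂m < ⊤ := by
  obtain ⟨B, hB⟩ := s.exists_forall_norm_le
  refine lt_of_le_of_lt (lintegral_mono (g := fun _ => (U B.toNNReal : ℝ≥0∞)) fun x => ?_) ?_
  · have : ‖s x‖₊ ≤ B.toNNReal := by
      rw [← norm_toNNReal]; exact Real.toNNReal_le_toNNReal (hB x)
    exact ENNReal.coe_le_coe.mpr (U.monotone this)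
  · rw [lintegral_const]
    exact ENNReal.mul_lt_top ENNReal.coe_lt_top (measure_lt_top m _)

variable (U m) in
/-- A simple function as an element of the Orlicz space over a finite measure. -/
noncomputable def simpleOrlicz (s : SimpleFunc α ℝ) : U.orliczSpace m :=
  ⟨AEEqFun.mk s s.aestronglyMeasurable, by
    refine mem_orliczSpace_of_modular_le (c := (∫⁻ x, (U ‖s x‖₊ : ℝ≥0∞) ∂m).toNNReal) ?_
    rw [modular_mk, ENNReal.coe_toNNReal (modular_simpleFunc_lt_top s).ne]⟩

theorem coe_simpleOrlicz (s : SimpleFunc α ℝ) :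
    ((simpleOrlicz m U s : U.orliczSpace m) : α →ₘ[m] ℝ) =
      AEEqFun.mk s s.aestronglyMeasurable := rfl

theorem simpleOrlicz_add (s t : SimpleFunc α ℝ) :
    simpleOrlicz m U (s + t) = simpleOrlicz m U s + simpleOrlicz m U t :=
  Subtype.ext rfl

theorem simpleOrlicz_smul (c : ℝ) (s : SimpleFunc α ℝ) :
    simpleOrlicz m U (c • s) = c • simpleOrlicz m U s :=
  Subtype.ext rfl

/-- The indicator function of `A`, as a simple function; it vanishes if `A` is not measurable. -/
noncomputable def simpleIndicator (A : Set α) : SimpleFunc α ℝ := (SimpleFunc.const α 1).restrict A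

theorem simpleIndicator_apply {A : Set α} (hA : MeasurableSet A) (x : α) :
    simpleIndicator A x = A.indicator 1 x := by
  rw [simpleIndicator, SimpleFunc.restrict_apply _ hA]
  rfl

/-- Indicators of sets of small measure are small in the Orlicz norm. -/
theorem norm_simpleOrlicz_indicator_le {A : Set α} (hA : MeasurableSet A) {c : ℝ≥0} (hc : 0 < c)
    (h : (U c : ℝ≥0∞) * m A ≤ 1) : ‖simpleOrlicz m U (simpleIndicator A)‖ ≤ (c : ℝ)⁻¹ := by
  have hc' : 0 < (c : ℝ)⁻¹ := by positivity
  refine norm_orlicz_le ⟨hc', ?_⟩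
  rw [inv_inv, coe_simpleOrlicz, modular_smul_eq]
  refine le_trans (le_of_eq ?_) h
  rw [← lintegral_indicator_const hA]
  refine lintegral_congr_ae ?_
  filter_upwards [AEEqFun.coeFn_mk (simpleIndicator A) (simpleIndicator A).aestronglyMeasurable
    (μ := m)] with x hx
  rw [hx, simpleIndicator_apply hA]
  by_cases hxA : x ∈ A
  · simp [hxA]
  · simp [hxA, U.map_zero]

/-- Every continuous functional on the Orlicz space is represented on simple functions by an
integrable function. -/
theorem exists_density_of_dual (φ : StrongDual ℝ (U.orliczSpace m)) :
    ∃ g : α → ℝ, Measurable g ∧ Integrable g m ∧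
      ∀ s : SimpleFunc α ℝ, φ (simpleOrlicz m U s) = ∫ x, s x * g x ∂m := by
  have hadd : ∀ A B : Set α, MeasurableSet A → MeasurableSet B → Disjoint A B →
      φ (simpleOrlicz m U (simpleIndicator (A ∪ B))) =
        φ (simpleOrlicz m U (simpleIndicator A)) + φ (simpleOrlicz m U (simpleIndicator B)) := by
    intro A B hA hB hAB
    rw [← map_add, ← simpleOrlicz_add]
    congr 2
    ext x
    rw [SimpleFunc.coe_add, Pi.add_apply, simpleIndicator_apply (hA.union hB),
      simpleIndicator_apply hA, simpleIndicator_apply hB, indicator_union_of_disjoint hAB]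
  have hsmall : ∀ ε : ℝ, 0 < ε → ∃ δ : ℝ, 0 < δ ∧ ∀ A, MeasurableSet A → m.real A < δ →
      |φ (simpleOrlicz m U (simpleIndicator A))| < ε := by
    intro ε hε
    -- If `U(k) m(A) ≤ 1` then the indicator of `A` has norm at most `1 / k`.
    obtain ⟨k, hk⟩ := exists_nat_gt (‖φ‖ / ε)
    have hk0 : 0 < (k : ℝ) := lt_of_le_of_lt (by positivity) hk
    have hk0' : 0 < (k : ℝ≥0) := by exact_mod_cast hk0
    refine ⟨((U (k : ℝ≥0) : ℝ) + 1)⁻¹, by positivity, fun A hA hmA => ?_⟩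
    have h1 : (U (k : ℝ≥0) : ℝ≥0∞) * m A ≤ 1 := by
      rw [← ENNReal.ofReal_coe_nnreal, ← ofReal_measureReal (measure_ne_top m A),
        ← ENNReal.ofReal_mul (NNReal.coe_nonneg _), ← ENNReal.ofReal_one]
      refine ENNReal.ofReal_le_ofReal ?_
      rw [← one_div, lt_div_iff₀ (by positivity)] at hmA
      have : 0 ≤ m.real A := measureReal_nonneg
      linarith
    have h2 := norm_simpleOrlicz_indicator_le hA hk0' h1
    calc |φ (simpleOrlicz m U (simpleIndicator A))|
        ≤ ‖φ‖ * ‖simpleOrlicz m U (simpleIndicator A)‖ := φ.le_opNorm _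
      _ ≤ ‖φ‖ * (k : ℝ)⁻¹ := by gcongr; exact_mod_cast h2
      _ < ε := by
        rw [← div_eq_mul_inv, div_lt_iff₀ hk0, mul_comm]
        exact (div_lt_iff₀ hε).mp hk
  obtain ⟨g, hgm, hgi, hg⟩ := exists_integrable_setIntegral_eq hadd hsmall
  refine ⟨g, hgm, hgi, fun s => ?_⟩
  have hint : ∀ s : SimpleFunc α ℝ, Integrable (fun x => s x * g x) m := by
    intro s
    obtain ⟨B, hB⟩ := s.exists_forall_norm_le
    exact hgi.bdd_mul s.aestronglyMeasurable (Eventually.of_forall hB)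
  induction s using SimpleFunc.induction with
  | const c hA =>
    rename_i A
    have h1 : SimpleFunc.piecewise A hA (SimpleFunc.const α c) (SimpleFunc.const α 0) =
        c • simpleIndicator A := by
      ext x
      rw [SimpleFunc.coe_smul, Pi.smul_apply, simpleIndicator_apply hA]
      by_cases hx : x ∈ A <;> simp [hx]
    rw [h1, simpleOrlicz_smul, map_smul, hg A hA, ← integral_indicator hA, smul_eq_mul,
      ← integral_const_mul]
    refine integral_congr_ae (Eventually.of_forall fun x => ?_)
    change _ = (c • simpleIndicator A) x * g x
    rw [SimpleFunc.coe_smul, Pi.smul_apply, simpleIndicator_apply hA]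
    by_cases hx : x ∈ A <;> simp [hx]
  | add _ h1 h2 =>
    rename_i s t _
    rw [simpleOrlicz_add, map_add, h1, h2, ← integral_add (hint s) (hint t)]
    refine integral_congr_ae (Eventually.of_forall fun x => ?_)
    change _ = (s + t) x * g x
    rw [SimpleFunc.coe_add, Pi.add_apply, add_mul]

end OrliczDual

/-! ### Duality and the `Δ₂` conditions -/

section OrliczDuality

variable {α : Type*} [MeasurableSpace α] {m : Measure α} {U : OrliczFunction}
  {F : ℝ → ℝ}

/-- The simple function equal to `1` where `g ≥ 0` and to `-1` elsewhere. -/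
noncomputable def simpleSign {g : α → ℝ} (hg : Measurable g) : SimpleFunc α ℝ :=
  SimpleFunc.piecewise {x | 0 ≤ g x} (measurableSet_le measurable_const hg)
    (SimpleFunc.const α 1) (SimpleFunc.const α (-1))

theorem simpleSign_mul_self {g : α → ℝ} (hg : Measurable g) (x : α) :
    simpleSign hg x * g x = |g x| := by
  by_cases hx : 0 ≤ g x
  · have : simpleSign hg x = 1 := by simp [simpleSign, hx]
    rw [this, one_mul, abs_of_nonneg hx]
  · have : simpleSign hg x = -1 := by simp [simpleSign, hx]
    rw [this, abs_of_neg (not_le.mp hx), neg_one_mul]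

theorem nnnorm_simpleSign {g : α → ℝ} (hg : Measurable g) (x : α) :
    ‖simpleSign hg x‖₊ = 1 := by
  by_cases hx : 0 ≤ g x <;> simp [simpleSign, hx]

theorem DeltaTwo.exists_pow_le {G : ℝ → ℝ} (hG : DeltaTwo G) :
    ∃ D : ℝ≥0, ∀ (j : ℕ) (x : ℝ), 0 < x → G (2 ^ j * x) ≤ D ^ j * G x := by
  obtain ⟨C, hC, h⟩ := hG
  refine ⟨⟨C, hC.le⟩, fun j x hx => ?_⟩
  change G (2 ^ j * x) ≤ C ^ j * G x
  induction j with
  | zero => simp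
  | succ j ih =>
    calc G (2 ^ (j + 1) * x) = G (2 * (2 ^ j * x)) := by congr 1; ring
      _ ≤ C * G (2 ^ j * x) := h _ (by positivity)
      _ ≤ C * (C ^ j * G x) := by gcongr
      _ = _ := by ring

theorem DeltaTwo.exists_pow_le_orlicz (hF : ∀ x : ℝ≥0, (U x : ℝ) = F x) (hΔ : DeltaTwo F) :
    ∃ D : ℝ≥0, ∀ (j : ℕ) (x : ℝ≥0), U (2 ^ j * x) ≤ D ^ j * U x := by
  obtain ⟨D, hD⟩ := hΔ.exists_pow_le
  refine ⟨D, fun j x => ?_⟩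
  rcases eq_or_ne x 0 with rfl | hx
  · simp [U.map_zero]
  · have h := hD j x (by positivity)
    rw [← NNReal.coe_le_coe, NNReal.coe_mul, hF, hF]
    push_cast
    exact h

/-- Young's inequality, with the factor `2 ^ j` absorbed by the `Δ₂` condition for the Legendre
transform: over the elements `u` of bounded modular, `∫ |u| |g|` over a set `S` is controlled by
`2⁻ʲ` plus a multiple of the integral of the Legendre transform over `S`. -/
theorem setLIntegral_mul_le_of_deltaTwo (hF : ∀ x : ℝ≥0, (U x : ℝ) = F x) (hcont : Continuous U)
    (hgrow : ∀ B : ℝ≥0, ∃ R : ℝ≥0, ∀ x, R ≤ x → B * x ≤ U x) {D : ℝ≥0}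
    (hD : ∀ (j : ℕ) (x : ℝ), 0 < x →
      legendreTransform F (2 ^ j * x) ≤ D ^ j * legendreTransform F x)
    {g : α → ℝ} {C : ℝ≥0} (hC : 0 < C) (u : α →ₘ[m] ℝ) (j : ℕ) (S : Set α) :
    ∫⁻ x in S, ‖u x * g x‖ₑ ∂m ≤ (C / 2 ^ j : ℝ≥0) * (U.modular m u +
      (D ^ j : ℝ≥0) * ∫⁻ x in S, ENNReal.ofReal (legendreTransform F (|g x| / C)) ∂m) := by
  have hpt : ∀ x, ‖u x * g x‖ₑ ≤ (C / 2 ^ j : ℝ≥0) * ((U ‖u x‖₊ : ℝ≥0∞) +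
      (D ^ j : ℝ≥0) * ENNReal.ofReal (legendreTransform F (|g x| / C))) := by
    intro x
    rcases eq_or_ne (g x) 0 with h0 | h0
    · simp [h0]
    have hV0 := legendre_nonneg hF hcont hgrow (|g x| / C)
    have hy : 0 < |g x| / C := div_pos (abs_pos.mpr h0) hC
    have h1 := mul_le_add_legendre hF hcont hgrow ‖u x‖₊ (2 ^ j * (|g x| / C))
    have h2 := h1.trans (add_le_add_right (hD j _ hy) _)
    have h3 : ‖u x * g x‖ ≤ (C / 2 ^ j) * (U ‖u x‖₊ +
        D ^ j * legendreTransform F (|g x| / C)) := by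
      have hC' : (C : ℝ) ≠ 0 := by exact_mod_cast hC.ne'
      calc ‖u x * g x‖ = (C / 2 ^ j) * (‖u x‖₊ * (2 ^ j * (|g x| / C))) := by
            rw [norm_mul, coe_nnnorm, Real.norm_eq_abs (g x)]
            field_simp
        _ ≤ _ := by gcongr
    rw [← ofReal_norm]
    refine (ENNReal.ofReal_le_ofReal h3).trans (le_of_eq ?_)
    rw [ENNReal.ofReal_mul (by positivity), ENNReal.ofReal_add (NNReal.coe_nonneg _)
      (by positivity), ENNReal.ofReal_mul (by positivity), ENNReal.ofReal_coe_nnreal]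
    congr 2
    · rw [← ENNReal.ofReal_coe_nnreal]; push_cast; rfl
    · congr 1
      rw [← ENNReal.ofReal_coe_nnreal]; push_cast; rfl
  calc ∫⁻ x in S, ‖u x * g x‖ₑ ∂m
      ≤ ∫⁻ x in S, (C / 2 ^ j : ℝ≥0) * ((U ‖u x‖₊ : ℝ≥0∞) +
          (D ^ j : ℝ≥0) * ENNReal.ofReal (legendreTransform F (|g x| / C))) ∂m :=
        lintegral_mono fun x => hpt x
    _ = (C / 2 ^ j : ℝ≥0) * (∫⁻ x in S, (U ‖u x‖₊ : ℝ≥0∞) ∂m +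
          (D ^ j : ℝ≥0) * ∫⁻ x in S, ENNReal.ofReal (legendreTransform F (|g x| / C)) ∂m) := by
        rw [lintegral_const_mul' _ _ ENNReal.coe_ne_top,
          lintegral_add_left' (U.aemeasurable_modular u).restrict,
          lintegral_const_mul' _ _ ENNReal.coe_ne_top]
    _ ≤ _ := by
        gcongr
        exact setLIntegral_le_lintegral _ _

variable [IsFiniteMeasure m]

/-- If `g` represents a functional `φ` and `v ≤ |g| / (‖φ‖ + 1)` is simple, test `φ` against the
simple function `σ(v) sign(g)`, where `σ(v)` nearly attains the supremum defining the Legendre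
transform at `v`. The modular of the test function appears on both sides and cancels. -/
theorem lintegral_legendre_simpleFunc_le (hF : ∀ x : ℝ≥0, (U x : ℝ) = F x) (hcont : Continuous U)
    (hgrow : ∀ B : ℝ≥0, ∃ R : ℝ≥0, ∀ x, R ≤ x → B * x ≤ U x)
    {φ : StrongDual ℝ (U.orliczSpace m)} {g : α → ℝ} (hgm : Measurable g) (hgi : Integrable g m)
    (hg : ∀ s : SimpleFunc α ℝ, φ (simpleOrlicz m U s) = ∫ x, s x * g x ∂m)
    (v : SimpleFunc α ℝ) (hv : ∀ x, v x ≤ |g x| / (‖φ‖ + 1)) :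
    ∫⁻ x, ENNReal.ofReal (legendreTransform F (v x)) ∂m ≤ 1 + m univ := by
  choose σ hσ using exists_legendre_sub_one_le hF
  have hC : 0 < ‖φ‖ + 1 := by positivity
  set s : SimpleFunc α ℝ := v.map fun y => (σ y : ℝ) with hs
  have hsx : ∀ x, s x = σ (v x) := fun x => rfl
  set t : SimpleFunc α ℝ := s * simpleSign hgm with ht
  have htx : ∀ x, ‖t x‖₊ = σ (v x) := by
    intro x
    rw [ht, SimpleFunc.coe_mul, Pi.mul_apply, nnnorm_mul, nnnorm_simpleSign, mul_one, hsx]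
    exact NNReal.nnnorm_eq _
  have hI : ∫⁻ x, (U (σ (v x)) : ℝ≥0∞) ∂m < ⊤ := by
    simpa only [htx] using modular_simpleFunc_lt_top (U := U) (m := m) t
  have hUm : Measurable fun x => (U (σ (v x)) : ℝ≥0∞) :=
    (v.map fun y => (U (σ y) : ℝ≥0∞)).measurable
  set I : ℝ≥0 := (∫⁻ x, (U (σ (v x)) : ℝ≥0∞) ∂m).toNNReal with hIdef
  have hIcoe : (I : ℝ≥0∞) = ∫⁻ x, (U (σ (v x)) : ℝ≥0∞) ∂m := ENNReal.coe_toNNReal hI.ne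
  have hnorm : ‖simpleOrlicz m U t‖ ≤ ((max 1 I : ℝ≥0) : ℝ) := by
    refine norm_orlicz_le (max_mem_scalings ?_)
    rw [coe_simpleOrlicz, modular_mk, hIcoe]
    simp only [htx, le_refl]
  have hpair : ∫ x, s x * (|g x| / (‖φ‖ + 1)) ∂m ≤ 1 + I := by
    have h1 : ∫ x, s x * (|g x| / (‖φ‖ + 1)) ∂m = φ (simpleOrlicz m U t) / (‖φ‖ + 1) := by
      rw [hg, ← integral_div]
      refine integral_congr_ae (Eventually.of_forall fun x => ?_)
      change s x * (|g x| / (‖φ‖ + 1)) = (s x * simpleSign hgm x) * g x / (‖φ‖ + 1)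
      rw [mul_assoc, simpleSign_mul_self, mul_div_assoc]
    rw [h1, div_le_iff₀ hC]
    -- The norm of the test function is bounded linearly by its modular, so that after dividing by
    -- `‖φ‖ + 1` the modular appears with coefficient one, as on the other side of the estimate.
    have hmax : ((max 1 I : ℝ≥0) : ℝ) ≤ 1 + I := by
      exact_mod_cast max_le (le_add_of_nonneg_right zero_le) (le_add_of_nonneg_left zero_le)
    calc φ (simpleOrlicz m U t) ≤ ‖φ‖ * ‖simpleOrlicz m U t‖ :=
          (le_abs_self _).trans (φ.le_opNorm _)
      _ ≤ (‖φ‖ + 1) * (1 + I) := by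
          gcongr
          · linarith
          · exact hnorm.trans hmax
      _ = _ := mul_comm _ _
  have hint : Integrable (fun x => s x * (|g x| / (‖φ‖ + 1))) m := by
    obtain ⟨B, hB⟩ := s.exists_forall_norm_le
    exact (hgi.abs.div_const _).bdd_mul s.aestronglyMeasurable (Eventually.of_forall hB)
  have hnn : ∀ x, 0 ≤ s x * (|g x| / (‖φ‖ + 1)) := fun x => by
    rw [hsx]; positivity
  have hmain : ∫⁻ x, ENNReal.ofReal (legendreTransform F (v x)) ∂m + I ≤ (1 + m univ) + I := by
    calc ∫⁻ x, ENNReal.ofReal (legendreTransform F (v x)) ∂m + I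
        = ∫⁻ x, (ENNReal.ofReal (legendreTransform F (v x)) + U (σ (v x))) ∂m := by
          rw [hIcoe, lintegral_add_right _ hUm]
      _ ≤ ∫⁻ x, (ENNReal.ofReal (s x * (|g x| / (‖φ‖ + 1))) + 1) ∂m := by
          refine lintegral_mono fun x => ?_
          rw [← ENNReal.ofReal_coe_nnreal, ← ENNReal.ofReal_one,
            ← ENNReal.ofReal_add (legendre_nonneg hF hcont hgrow _) (NNReal.coe_nonneg _),
            ← ENNReal.ofReal_add (hnn x) zero_le_one]
          refine ENNReal.ofReal_le_ofReal ((hσ (v x)).trans ?_)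
          rw [hsx]
          gcongr
          exact hv x
      _ = ENNReal.ofReal (∫ x, s x * (|g x| / (‖φ‖ + 1)) ∂m) + m univ := by
          rw [lintegral_add_right _ measurable_const, lintegral_one,
            ofReal_integral_eq_lintegral_ofReal hint (Eventually.of_forall hnn)]
      _ ≤ ENNReal.ofReal (1 + I) + m univ := by gcongr
      _ = _ := by
          rw [ENNReal.ofReal_add zero_le_one I.coe_nonneg, ENNReal.ofReal_one,
            ENNReal.ofReal_coe_nnreal]
          ring
  exact (ENNReal.add_le_add_iff_right ENNReal.coe_ne_top).mp hmain

/-- The density representing a continuous functional on `L_U` lies in the Orlicz class of the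
Legendre transform, up to scaling. -/
theorem lintegral_legendre_density_le (hF : ∀ x : ℝ≥0, (U x : ℝ) = F x) (hcont : Continuous U)
    (hgrow : ∀ B : ℝ≥0, ∃ R : ℝ≥0, ∀ x, R ≤ x → B * x ≤ U x)
    {φ : StrongDual ℝ (U.orliczSpace m)} {g : α → ℝ} (hgm : Measurable g) (hgi : Integrable g m)
    (hg : ∀ s : SimpleFunc α ℝ, φ (simpleOrlicz m U s) = ∫ x, s x * g x ∂m) :
    ∫⁻ x, ENNReal.ofReal (legendreTransform F (|g x| / (‖φ‖ + 1))) ∂m ≤ 1 + m univ := by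
  have hC : 0 < ‖φ‖ + 1 := by positivity
  let h : α → ℝ≥0∞ := fun x => ENNReal.ofReal (|g x| / (‖φ‖ + 1))
  have hhm : Measurable h := (hgm.abs.div_const _).ennreal_ofReal
  have hh0 : ∀ x, 0 ≤ |g x| / (‖φ‖ + 1) := fun x => by positivity
  let v : ℕ → SimpleFunc α ℝ := fun n => (SimpleFunc.eapprox h n).map ENNReal.toReal
  have hvx : ∀ n x, v n x = (SimpleFunc.eapprox h n x).toReal := fun n x => rfl
  have hvle : ∀ n x, v n x ≤ |g x| / (‖φ‖ + 1) := by
    intro n x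
    rw [hvx, ← ENNReal.toReal_ofReal (hh0 x)]
    refine ENNReal.toReal_mono ENNReal.ofReal_ne_top ?_
    change _ ≤ h x
    rw [← SimpleFunc.iSup_eapprox_apply hhm x]
    exact le_iSup (fun n => SimpleFunc.eapprox h n x) n
  have hvlim : ∀ x, Tendsto (fun n => v n x) atTop (𝓝 (|g x| / (‖φ‖ + 1))) := by
    intro x
    rw [← ENNReal.toReal_ofReal (hh0 x)]
    exact (ENNReal.tendsto_toReal ENNReal.ofReal_ne_top).comp (SimpleFunc.tendsto_eapprox hhm x)
  have hV := continuous_legendre hF hgrow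
  calc ∫⁻ x, ENNReal.ofReal (legendreTransform F (|g x| / (‖φ‖ + 1))) ∂m
      = ∫⁻ x, liminf (fun n => ENNReal.ofReal (legendreTransform F (v n x))) atTop ∂m := by
        refine lintegral_congr fun x => ?_
        refine (Tendsto.liminf_eq ?_).symm
        exact ((ENNReal.continuous_ofReal.comp hV).tendsto _).comp (hvlim x)
    _ ≤ liminf (fun n => ∫⁻ x, ENNReal.ofReal (legendreTransform F (v n x)) ∂m) atTop :=
        lintegral_liminf_le fun n => (hV.measurable.comp (v n).measurable).ennreal_ofReal
    _ ≤ 1 + m univ := by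
        refine liminf_le_of_le (by isBoundedDefault) fun b hb => ?_
        obtain ⟨n, hn⟩ := hb.exists
        exact hn.trans (lintegral_legendre_simpleFunc_le hF hcont hgrow hgm hgi hg (v n) (hvle n))

/-- If `U` satisfies the `Δ₂` condition, simple functions are dense in `L_U`: every element is the
norm limit of simple functions dominated by twice its absolute value. -/
theorem exists_simpleOrlicz_tendsto (hcont : Continuous U) {D : ℝ≥0}
    (hD : ∀ (j : ℕ) (x : ℝ≥0), U (2 ^ j * x) ≤ D ^ j * U x) (u : U.orliczSpace m)
    (hu : U.modular m u.1 ≠ ⊤) :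
    ∃ s : ℕ → SimpleFunc α ℝ, (∀ n x, ‖s n x‖ ≤ 2 * ‖u.1 x‖) ∧
      (∀ x, Tendsto (fun n => s n x) atTop (𝓝 (u.1 x))) ∧
      Tendsto (fun n => simpleOrlicz m U (s n)) atTop (𝓝 u) := by
  have hum : Measurable (u.1 : α → ℝ) := u.1.measurable
  let s : ℕ → SimpleFunc α ℝ := SimpleFunc.approxOn u.1 hum univ 0 (mem_univ 0)
  have hs1 : ∀ n x, ‖s n x‖ ≤ 2 * ‖u.1 x‖ := fun n x => by
    rw [two_mul]
    exact SimpleFunc.norm_approxOn_zero_le hum (mem_univ 0) x n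
  have hs2 : ∀ x, Tendsto (fun n => s n x) atTop (𝓝 (u.1 x)) := fun x =>
    SimpleFunc.tendsto_approxOn hum (mem_univ 0) (by simp)
  refine ⟨s, hs1, hs2, ?_⟩
  have hmod : ∀ j : ℕ, Tendsto (fun n => ∫⁻ x, (U (2 ^ j * ‖s n x - u.1 x‖₊) : ℝ≥0∞) ∂m) atTop
      (𝓝 0) := by
    intro j
    have h0 : ∫⁻ x : α, (0 : ℝ≥0∞) ∂m = 0 := lintegral_zero
    rw [← h0]
    refine tendsto_lintegral_of_dominated_convergence
      (fun x => ((D ^ (j + 2) : ℝ≥0) : ℝ≥0∞) * (U ‖u.1 x‖₊ : ℝ≥0∞)) (fun n => ?_) (fun n => ?_) ?_ ?_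
    · exact (U.measurable.comp (((s n).measurable.sub hum).nnnorm.const_mul _)).coe_nnreal_ennreal
    · refine Eventually.of_forall fun x => ?_
      beta_reduce
      rw [← ENNReal.coe_mul]
      refine ENNReal.coe_le_coe.mpr ((U.monotone ?_).trans (hD (j + 2) _))
      -- The constant `4`, unlike the sharp `3`, is a power of two, as the iterated `Δ₂` bound needs.
      have h1 : ‖s n x - u.1 x‖₊ ≤ 4 * ‖u.1 x‖₊ := by
        rw [← NNReal.coe_le_coe]
        push_cast
        have h2 := hs1 n x
        have h3 := norm_sub_le (s n x) (u.1 x)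
        have h4 := norm_nonneg (u.1 x)
        linarith
      calc 2 ^ j * ‖s n x - u.1 x‖₊ ≤ 2 ^ j * (4 * ‖u.1 x‖₊) := by gcongr
        _ = 2 ^ (j + 2) * ‖u.1 x‖₊ := by ring
    · rw [lintegral_const_mul' _ _ ENNReal.coe_ne_top]
      exact ENNReal.mul_ne_top ENNReal.coe_ne_top hu
    · refine Eventually.of_forall fun x => ?_
      have hc : Continuous fun y : ℝ => (U (2 ^ j * ‖y - u.1 x‖₊) : ℝ≥0∞) :=
        ENNReal.continuous_coe.comp (hcont.comp (by fun_prop))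
      have := (hc.tendsto (u.1 x)).comp (hs2 x)
      simp only [sub_self, nnnorm_zero, mul_zero, U.map_zero, ENNReal.coe_zero] at this
      exact this
  rw [Metric.tendsto_nhds]
  intro ε hε
  obtain ⟨j, hj⟩ := exists_pow_lt_of_lt_one hε (by norm_num : (2 : ℝ)⁻¹ < 1)
  filter_upwards [(hmod j).eventually (Iic_mem_nhds one_pos)] with n hn
  rw [dist_eq_norm]
  refine lt_of_le_of_lt (norm_orlicz_le ⟨by positivity, ?_⟩) hj
  rw [modular_smul_eq]
  refine le_trans (le_of_eq (lintegral_congr_ae ?_)) hn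
  filter_upwards [AEEqFun.coeFn_sub ((simpleOrlicz m U (s n)).1) u.1,
    AEEqFun.coeFn_mk (s n) (s n).aestronglyMeasurable (μ := m)] with x h1 h2
  have h3 : ((simpleOrlicz m U (s n) - u).1 : α → ℝ) x = s n x - u.1 x := by
    change ((simpleOrlicz m U (s n)).1 - u.1 : α →ₘ[m] ℝ) x = _
    rw [h1, Pi.sub_apply, coe_simpleOrlicz, h2]
  rw [h3]
  congr 3
  simp

end OrliczDuality

/-! ### Weak compactness in the Orlicz space -/

section WeakCompactnessInOrliczSpace

variable {α : Type*} [MeasurableSpace α] {m : Measure α} [IsFiniteMeasure m] {U : OrliczFunction}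
  {F : ℝ → ℝ}

/-- When `U` and its Legendre transform satisfy the `Δ₂` condition, every continuous functional on
`L_U` is, uniformly on sets of bounded modular, a limit of pairings with bounded functions. -/
theorem exists_bounded_density_approx (hF : ∀ x : ℝ≥0, (U x : ℝ) = F x) (hcont : Continuous U)
    (hgrow : ∀ B : ℝ≥0, ∃ R : ℝ≥0, ∀ x, R ≤ x → B * x ≤ U x)
    (hΔ : DeltaTwo F) (hΔ' : DeltaTwo (legendreTransform F)) (φ : StrongDual ℝ (U.orliczSpace m))
    (K : ℝ≥0) {ε : ℝ} (hε : 0 < ε) :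
    ∃ (h : α → ℝ) (B : ℝ), Measurable h ∧ (∀ x, ‖h x‖ ≤ B) ∧
      ∀ u : U.orliczSpace m, U.modular m u.1 ≤ K → |φ u - ∫ x, u.1 x * h x ∂m| ≤ ε := by
  obtain ⟨g, hgm, hgi, hg⟩ := exists_density_of_dual φ
  obtain ⟨D, hD⟩ := hΔ.exists_pow_le_orlicz hF
  obtain ⟨E, hE⟩ := hΔ'.exists_pow_le
  set C : ℝ≥0 := ‖φ‖₊ + 1 with hCdef
  have hC : 0 < C := by positivity
  have hCcoe : (C : ℝ) = ‖φ‖ + 1 := rfl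
  have hVfin : ∫⁻ x, ENNReal.ofReal (legendreTransform F (|g x| / C)) ∂m ≠ ⊤ :=
    ne_top_of_le_ne_top (ENNReal.add_ne_top.mpr ⟨ENNReal.one_ne_top, measure_ne_top m _⟩)
      (lintegral_legendre_density_le hF hcont hgrow hgm hgi hg)
  have hbound := fun (u : α →ₘ[m] ℝ) => setLIntegral_mul_le_of_deltaTwo hF hcont hgrow hE hC u
    (g := g)
  have hint : ∀ u : U.orliczSpace m, U.modular m u.1 ≤ K →
      Integrable (fun x => u.1 x * g x) m := by
    intro u hu
    refine ⟨u.1.aestronglyMeasurable.mul hgm.aestronglyMeasurable, ?_⟩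
    have h1 := hbound u.1 0 univ
    rw [setLIntegral_univ, setLIntegral_univ] at h1
    refine lt_of_le_of_lt h1 (ENNReal.mul_lt_top ENNReal.coe_lt_top (ENNReal.add_lt_top.mpr
      ⟨hu.trans_lt ENNReal.coe_lt_top, ENNReal.mul_lt_top ENNReal.coe_lt_top hVfin.lt_top⟩))
  have hrep : ∀ u : U.orliczSpace m, U.modular m u.1 ≤ K → φ u = ∫ x, u.1 x * g x ∂m := by
    intro u hu
    obtain ⟨s, hs1, hs2, hs3⟩ := exists_simpleOrlicz_tendsto hcont hD u
      (ne_top_of_le_ne_top ENNReal.coe_ne_top hu)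
    have h1 : Tendsto (fun n => φ (simpleOrlicz m U (s n))) atTop (𝓝 (φ u)) :=
      (φ.continuous.tendsto u).comp hs3
    refine tendsto_nhds_unique h1 ?_
    simp only [hg]
    refine tendsto_integral_of_dominated_convergence (fun x => 2 * ‖u.1 x * g x‖)
      (fun n => (s n).aestronglyMeasurable.mul hgm.aestronglyMeasurable)
      ((hint u hu).norm.const_mul 2) (fun n => Eventually.of_forall fun x => ?_)
      (Eventually.of_forall fun x => (hs2 x).mul_const _)
    rw [norm_mul, norm_mul, ← mul_assoc]
    gcongr
    exact hs1 n x
  let S : ℕ → Set α := fun k => {x | (k : ℝ) < |g x|}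
  have hSm : ∀ k, MeasurableSet (S k) := fun k => measurableSet_lt measurable_const hgm.abs
  have hS0 : Tendsto (m ∘ S) atTop (𝓝 0) := by
    have hempty : ⋂ k, S k = ∅ := by
      refine eq_empty_of_forall_notMem fun x hx => ?_
      obtain ⟨k, hk⟩ := exists_nat_gt |g x|
      exact lt_asymm hk (mem_iInter.mp hx k)
    have := tendsto_measure_iInter_atTop (μ := m) (fun k => (hSm k).nullMeasurableSet)
      (fun a b hab x (hx : (b : ℝ) < |g x|) => lt_of_le_of_lt (Nat.cast_le.mpr hab) hx) ⟨0, measure_ne_top m _⟩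
    rwa [hempty, measure_empty] at this
  obtain ⟨j, hj⟩ : ∃ j : ℕ, ((C / 2 ^ j : ℝ≥0) : ℝ≥0∞) * K < ENNReal.ofReal ε := by
    obtain ⟨j, hj⟩ := exists_pow_lt_of_lt_one (show 0 < ε / (C * K + 1) by positivity)
      (by norm_num : (2 : ℝ)⁻¹ < 1)
    refine ⟨j, ?_⟩
    rw [← ENNReal.coe_mul, ← ENNReal.ofReal_coe_nnreal]
    refine (ENNReal.ofReal_lt_ofReal_iff hε).mpr ?_
    push_cast
    rw [lt_div_iff₀ (by positivity), inv_pow] at hj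
    have h2 : 0 < ((2 : ℝ) ^ j)⁻¹ := by positivity
    rw [div_eq_mul_inv]
    nlinarith
  -- First `j` makes the modular term small, then `k` makes the tail of the Legendre integral small.
  obtain ⟨k, hk⟩ : ∃ k, (C / 2 ^ j : ℝ≥0) * ((K : ℝ≥0∞) + (E ^ j : ℝ≥0) *
      ∫⁻ x in S k, ENNReal.ofReal (legendreTransform F (|g x| / C)) ∂m) < ENNReal.ofReal ε := by
    have h1 := tendsto_setLIntegral_zero hVfin hS0
    have h2 := ENNReal.Tendsto.const_mul (ENNReal.Tendsto.const_mul h1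
      (Or.inr (ENNReal.coe_ne_top (r := E ^ j))) |>.const_add (K : ℝ≥0∞))
      (Or.inr (ENNReal.coe_ne_top (r := C / 2 ^ j)))
    rw [mul_zero, add_zero] at h2
    exact (h2.eventually (Iio_mem_nhds hj)).exists
  refine ⟨(S k)ᶜ.indicator g, k, hgm.indicator (hSm k).compl, fun x => ?_, fun u hu => ?_⟩
  · by_cases hx : x ∈ S k
    · simp [hx]
    · rw [indicator_of_mem (mem_compl hx)]
      exact not_lt.mp hx
  · have hsplit : φ u - ∫ x, u.1 x * (S k)ᶜ.indicator g x ∂m = ∫ x in S k, u.1 x * g x ∂m := by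
      have h1 : ∀ x, u.1 x * (S k)ᶜ.indicator g x =
          (S k)ᶜ.indicator (fun x => u.1 x * g x) x := fun x => by
        by_cases hx : x ∈ S k <;> simp [hx]
      simp only [h1]
      rw [hrep u hu, integral_indicator (hSm k).compl,
        ← integral_add_compl (hSm k) (hint u hu), add_sub_cancel_right]
    rw [hsplit, ← Real.norm_eq_abs, ← toReal_enorm]
    refine ENNReal.toReal_le_of_le_ofReal hε.le ?_
    refine (enorm_integral_le_lintegral_enorm _).trans ((hbound u.1 j (S k)).trans ?_)
    exact (mul_le_mul_right (add_le_add_left hu _) _).trans hk.le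

/-- On sets of bounded modular, the weak topology of `L_U` is not finer than that of `L¹` when both
`Δ₂` conditions hold, so weak compactness passes from `L¹` to `L_U`. -/
theorem isCompact_weak_orliczSpace (hF : ∀ x : ℝ≥0, (U x : ℝ) = F x) (hcont : Continuous U)
    (hgrow : ∀ B : ℝ≥0, ∃ R : ℝ≥0, ∀ x, R ≤ x → B * x ≤ U x)
    (hΔ : DeltaTwo F) (hΔ' : DeltaTwo (legendreTransform F)) {A : Set (Lp ℝ 1 m)} {K : ℝ≥0}
    (hA : ∀ ρ ∈ A, U.modular m (ρ : α →ₘ[m] ℝ) ≤ K)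
    (hcpt : IsCompact (toWeakSpace ℝ (Lp ℝ 1 m) '' A)) :
    IsCompact (toWeakSpace ℝ (U.orliczSpace m) '' {u | ∃ ρ ∈ A, (ρ : α →ₘ[m] ℝ) = u}) := by
  classical
  -- The inclusion of `A` into `L_U`, extended by `0` to all of `L¹`.
  let J : Lp ℝ 1 m → U.orliczSpace m := fun ρ =>
    if h : (ρ : α →ₘ[m] ℝ) ∈ U.orliczSpace m then ⟨ρ, h⟩ else 0
  have hJ : ∀ ρ ∈ A, ((J ρ : U.orliczSpace m) : α →ₘ[m] ℝ) = ρ := fun ρ hρ => by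
    simp only [J, dif_pos (mem_orliczSpace_of_modular_le (hA ρ hρ))]
  have hcontJ : ContinuousOn
      (fun w => toWeakSpace ℝ (U.orliczSpace m) (J ((toWeakSpace ℝ (Lp ℝ 1 m)).symm w)))
      (toWeakSpace ℝ (Lp ℝ 1 m) '' A) := by
    rw [continuousOn_iff_continuous_domRestrict]
    refine WeakBilin.continuous_of_continuous_eval _ fun φ => ?_
    rw [continuous_iff_continuousAt]
    intro w₀
    rw [ContinuousAt, Metric.tendsto_nhds]
    intro ε hε
    obtain ⟨h, B, hm, hB, happ⟩ := exists_bounded_density_approx hF hcont hgrow hΔ hΔ' φ K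
      (show 0 < ε / 3 by positivity)
    obtain ⟨ψ, hψ⟩ := exists_dual_eq_integral_mul h hm.aestronglyMeasurable B hB
    have hψc : Continuous fun w : toWeakSpace ℝ (Lp ℝ 1 m) '' A =>
        ψ ((toWeakSpace ℝ (Lp ℝ 1 m)).symm w) :=
      (continuous_dual_comp_toWeakSpace_symm ψ).comp continuous_subtype_val
    have hclose : ∀ w : toWeakSpace ℝ (Lp ℝ 1 m) '' A,
        |φ (J ((toWeakSpace ℝ (Lp ℝ 1 m)).symm w)) - ψ ((toWeakSpace ℝ (Lp ℝ 1 m)).symm w)|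
          ≤ ε / 3 := by
      rintro ⟨_, ρ, hρ, rfl⟩
      have h1 := happ (J ρ) (by rw [hJ ρ hρ]; exact hA ρ hρ)
      rw [hJ ρ hρ] at h1
      rw [LinearEquiv.symm_apply_apply, hψ]
      exact h1
    filter_upwards [Metric.tendsto_nhds.mp (hψc.tendsto w₀) (ε / 3) (by positivity)] with w hw
    change |φ (J ((toWeakSpace ℝ (Lp ℝ 1 m)).symm w)) -
      φ (J ((toWeakSpace ℝ (Lp ℝ 1 m)).symm w₀))| < ε
    have h1 := abs_le.mp (hclose w)
    have h2 := abs_le.mp (hclose w₀)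
    rw [Real.dist_eq] at hw
    have h3 := abs_lt.mp hw
    rw [abs_lt]
    constructor <;> linarith
  have himage := hcpt.image_of_continuousOn hcontJ
  rw [image_image] at himage
  simp only [LinearEquiv.symm_apply_apply] at himage
  convert himage using 1
  ext w
  constructor
  · rintro ⟨u, ⟨ρ, hρ, hu⟩, rfl⟩
    exact ⟨ρ, hρ, congrArg _ (Subtype.ext ((hJ ρ hρ).trans hu))⟩
  · rintro ⟨ρ, hρ, rfl⟩
    exact ⟨J ρ, ⟨ρ, hρ, (hJ ρ hρ).symm⟩, rfl⟩

end WeakCompactnessInOrliczSpace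

theorem proposition5 {M : Type*} [MetricSpace M] [CompactSpace M] [MeasurableSpace M]
    [BorelSpace M] (m : Measure M) [IsFiniteMeasure m] (Θ : ℝ → ℝ)
    (hmono : StrictMono fun r : ℝ => Θ (Real.exp r))
    (hconv : ConvexOn ℝ univ fun r : ℝ => Θ (Real.exp r))
    (htop : Tendsto (fun r : ℝ => Θ (Real.exp r)) atTop atTop)
    (hbot : Tendsto (fun r : ℝ => Θ (Real.exp r)) atBot (𝓝 0)) :
    (∀ ρ : Lp ℝ 1 m, IsProbDensity m ρ →
      internalEnergy Θ m ρ ≤ ENNReal.ofReal (2 * Θ 4) +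
        2 * ∫⁻ l in Ioi (0 : ℝ),
          ENNReal.ofReal (Θ (2 / (m {x | l < ρ x}).toReal) * (m {x | l < ρ x}).toReal)) ∧
    (∀ (f : Lp ℝ 1 m) (K : ℝ), IsProbDensity m f → 1 < K →
      internalEnergy Θ m f < ENNReal.ofReal K →
        (IsClosed (energySublevel Θ m f K) ∧
          IsClosed (toWeakSpace ℝ (Lp ℝ 1 m) '' energySublevel Θ m f K) ∧
          Convex ℝ (energySublevel Θ m f K) ∧
          IsSeqCompact (toWeakSpace ℝ (Lp ℝ 1 m) '' energySublevel Θ m f K)) ∧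
        (∃! ρ₁ : Lp ℝ 1 m, ρ₁ ∈ energySublevel Θ m f K ∧
          ∀ ρ ∈ energySublevel Θ m f K, totalEnergy Θ m f ρ₁ ≤ totalEnergy Θ m f ρ) ∧
        (DeltaTwo (fun x => x * Θ x) → DeltaTwo (legendreTransform fun x => x * Θ x) →
          ∃ U : OrliczFunction, (∀ x : ℝ≥0, (U x : ℝ) = x * Θ x) ∧
            (∀ ρ ∈ energySublevel Θ m f K, (ρ : M →ₘ[m] ℝ) ∈ U.orliczSpace m) ∧
            IsCompact (toWeakSpace ℝ (U.orliczSpace m) ''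
              {u | ∃ ρ ∈ energySublevel Θ m f K, (ρ : M →ₘ[m] ℝ) = u}))) := by
  obtain ⟨U, hU, hstrict, hcont, hgrow⟩ := exists_orliczFunction_mul_theta hmono hconv htop hbot
  -- The superlevel set integral alone dominates the internal energy, and `2 Θ(4)` enters through
  -- `ENNReal.ofReal`, so adding it only weakens the bound.
  refine ⟨fun ρ hρ => le_add_left (internalEnergy_le_lintegral_superlevel hmono hρ),
    fun f K hf _ hK => ⟨⟨isClosed_sublevel_totalEnergy hU hcont hf _,
      isClosed_weak_sublevel_totalEnergy hU hcont hf _, convex_sublevel_totalEnergy hU hf _,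
      isSeqCompact_weak_energySublevel hU hcont hgrow hf K⟩, ?_, fun hΔ hΔ' => ?_⟩⟩
  · obtain ⟨ρ₁, hρ₁, hmin⟩ := exists_minimizer_totalEnergy hU hcont hgrow hf hK
    exact ⟨ρ₁, ⟨hρ₁, hmin⟩, fun σ hσ =>
      minimizer_totalEnergy_unique hU hstrict hf hσ.1 hρ₁ hσ.2 hmin⟩
  · have hA : ∀ ρ ∈ energySublevel Θ m f K, U.modular m (ρ : M →ₘ[m] ℝ) ≤ K.toNNReal :=
      fun ρ hρ => modular_le_of_mem_energySublevel hU hρ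
    exact ⟨U, hU, fun ρ hρ => mem_orliczSpace_of_modular_le (hA ρ hρ),
      isCompact_weak_orliczSpace hU hcont hgrow hΔ hΔ' hA
        (isCompact_weak_energySublevel hU hcont hgrow hf K)⟩
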